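/- **Setting.** There are $K\ge 2$ arms and $T$ rounds. In round $t$ the environment generates a loss vector $\ell_t\in[0,1]^K$, possibly at random and depending on the past but not on the learner's fresh randomness of round $t$. The learner exploits an arm $i_t$ (suffering $\ell_{t,i_t}$, unobserved) and explores an arm $j_t$ (observing $\ell_{t,j_t}$). The pseudo-regret is $\mathrm{Reg}(T)=\mathbb E\big[\sum_{t=1}^T\ell_{t,i_t}\big]-\min_i\mathbb E\big[\sum_{t=1}^T\ell_{t,i}\big]$. In the stochastically constrained adversarial regime there are fixed numbers $\Delta_{i,j}$ such that, for all $t\in\{1,\dots,T\}$ and all $i,j$, the conditional expectation of $\ell_{t,i}-\ell_{t,j}$ given the history before round $t$ equals $\Delta_{i,j}$. The arm $i^*$ is the unique best arm if $\Delta_i:=\Delta_{i,i^*}>0$ for all $i\ne i^*$; let $\Delta_{\min}=\min_{i\ne i^*}\Delta_i$. **Algorithm** (shape $\alpha$, learning rates $\eta_t$). Start with $\hat L_1=0\in\mathbb R^K$. In round $t$, draw $r_{t,1},\dots,r_{t,K}$ i.i.d. from the Pareto distribution with density $\alpha x^{-\alpha-1}$ on $[1,\infty)$ and exploit $i_t\in\arg\min_i\{\hat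 L_{t,i}-r_{t,i}/\eta_t\}$. Explore $j_t$ drawn with probabilities $p_{t,i}=q_{t,i}/\sum_j q_{t,j}$, where $$q_{t,i}=\Big(\min\Big\{\frac1{1+\eta_t(\hat L_{t,i}-\min_k\hat L_{t,k})},\ \frac1{\sigma_{t,i}^{1/\alpha}}\Big\}\Big)^{\frac{\alpha+1}2}$$ and $\sigma_{t,i}\in\{1,\dots,K\}$ is the rank of $\hat L_{t,i}$ in increasing order (ties broken arbitrarily). Then set $\hat L_{t+1}=\hat L_t+\ell_{t,j_t}p_{t,j_t}^{-1}e_{j_t}$. **Theorem.** Let $\alpha\in(1,3]$ and $c>0$. There is a constant $C>0$, depending only on $\alpha$ and $c$, such that for all $K\ge2$ and $T$, for every environment in the stochastically constrained adversarial regime with a unique best arm $i^*$, the algorithm with $\eta_t=cK^{\frac1\alpha-\frac12}/\sqrt t$ satisfies $$\mathrm{Reg}(T)\le C\Big(\sum_{t=1}^T\sum_{i\ne i^*}\sqrt K\,\Delta_i^{1-\alpha}t^{-\alpha/2}+\frac K{\Delta_{\min}}\Big).$$ If moreover $\alpha\in(2,3]$, then $C$ can be chosen so that also, with a right-hand side independent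 of $T$, $$\mathrm{Reg}(T)\le C\Big(\sum_{i\ne i^*}\sqrt K\,\Delta_i^{1-\alpha}+\frac K{\Delta_{\min}}\Big)\qquad\text{for all }T.$$ -/

import Mathlib

open MeasureTheory ProbabilityTheory

/-- The loss gap `L i - min_k L k` of a vector of (estimated) cumulative losses. -/
noncomputable def lossGap {K : ℕ} (L : Fin K → ℝ) (i : Fin K) : ℝ :=
  L i - ⨅ k, L k

/-- The unnormalised exploration weight
`q_i = ((1 / (1 + η * gap_i)) ∧ (1 / σ_i ^ (1 / α))) ^ ((α + 1) / 2)`,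
where `σ i` is the rank (from `1` for the smallest to `K` for the largest) of `L i`. -/
noncomputable def exploreWeight {K : ℕ} (α η : ℝ) (L : Fin K → ℝ) (σ : Fin K → ℕ)
    (i : Fin K) : ℝ :=
  (min (1 / (1 + η * lossGap L i)) (1 / (σ i : ℝ) ^ (1 / α))) ^ ((α + 1) / 2)

/-- The exploration probability `p_i = q_i / ∑ j, q_j`. -/
noncomputable def exploreProb {K : ℕ} (α η : ℝ) (L : Fin K → ℝ) (σ : Fin K → ℕ)
    (i : Fin K) : ℝ :=
  exploreWeight α η L σ i / ∑ j, exploreWeight α η L σ j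

/-- `σ` is a ranking of the entries of `L` in increasing order, with values `1, …, K`;
ties are broken arbitrarily. -/
def IsRanking {K : ℕ} (L : Fin K → ℝ) (σ : Fin K → ℕ) : Prop :=
  Set.BijOn σ Set.univ (Set.Icc 1 K) ∧ ∀ i j, L i < L j → σ i < σ j

/-- A run, over the rounds `1, …, T`, of follow-the-perturbed-leader with Pareto perturbations
of shape `α` and learning rates `η t`, for decoupled exploration and exploitation with `K` arms,
against an arbitrary (possibly randomised and adaptive) environment, on a probability space
`(Ω, P)`.

`history t` is the information that is available before round `t`. It contains everything that the
learner has drawn and observed in the earlier rounds, and possibly more (such as private randomness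
of the environment, or unobserved past losses). In round `t` the loss vector is generated in an
arbitrary way that may depend on `history t`, but not on the randomness that the learner uses
in round `t`. -/
structure FTPLRun {Ω : Type*} [mΩ : MeasurableSpace Ω] (P : Measure Ω) (K T : ℕ) (α : ℝ)
    (η : ℕ → ℝ) where
  /-- the information available before round `t` -/
  history : Filtration ℕ mΩ
  /-- the loss vector of round `t` -/
  loss : ℕ → Ω → Fin K → ℝ
  /-- the perturbation vector of round `t` -/
  pert : ℕ → Ω → Fin K → ℝ
  /-- the arm exploited in round `t` -/
  exploit : ℕ → Ω → Fin K
  /-- the arm explored in round `t` -/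
  explore : ℕ → Ω → Fin K
  /-- the estimated cumulative losses before round `t` -/
  lhat : ℕ → Ω → Fin K → ℝ
  /-- the ranks of the estimated cumulative losses before round `t` -/
  rank : ℕ → Ω → Fin K → ℕ
  -- the losses are random variables with values in `[0, 1]`
  measurable_loss : ∀ t ∈ Finset.Icc 1 T, Measurable (loss t)
  loss_mem : ∀ t ∈ Finset.Icc 1 T, ∀ ω i, loss t ω i ∈ Set.Icc (0 : ℝ) 1
  -- what the learner draws and observes in round `t` belongs to the history of the next round
  measurable_pert : ∀ t ∈ Finset.Icc 1 T, Measurable[history (t + 1)] (pert t)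
  measurable_exploit : ∀ t ∈ Finset.Icc 1 T, Measurable[history (t + 1)] (exploit t)
  measurable_explore : ∀ t ∈ Finset.Icc 1 T, Measurable[history (t + 1)] (explore t)
  measurable_observed : ∀ t ∈ Finset.Icc 1 T,
    Measurable[history (t + 1)] (fun ω => loss t ω (explore t ω))
  -- the ranks are computed from the history
  measurable_rank : ∀ t ∈ Finset.Icc 1 T, Measurable[history t] (rank t)
  isRanking : ∀ t ∈ Finset.Icc 1 T, ∀ ω, IsRanking (lhat t ω) (rank t ω)
  -- the perturbations are i.i.d. Pareto, and independent of the past and of the current losses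
  map_pert : ∀ t ∈ Finset.Icc 1 T, P.map (pert t) = Measure.pi (fun _ => paretoMeasure 1 α)
  indep_pert : ∀ t ∈ Finset.Icc 1 T,
    Indep (MeasurableSpace.comap (pert t) inferInstance)
      (history t ⊔ MeasurableSpace.comap (loss t) inferInstance) P
  -- exploitation: the perturbed leader
  exploit_argmin : ∀ t ∈ Finset.Icc 1 T, ∀ ω k,
    lhat t ω (exploit t ω) - pert t ω (exploit t ω) / η t ≤ lhat t ω k - pert t ω k / η t
  -- exploration: a fresh draw from the exploration probabilities
  condExp_explore : ∀ t ∈ Finset.Icc 1 T, ∀ i,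
    P[(explore t ⁻¹' {i}).indicator (fun _ => (1 : ℝ)) |
        history t ⊔ MeasurableSpace.comap (loss t) inferInstance ⊔
          MeasurableSpace.comap (pert t) inferInstance]
      =ᵐ[P] fun ω => exploreProb α (η t) (lhat t ω) (rank t ω) i
  -- importance-weighted estimation of the cumulative losses
  lhat_one : ∀ ω, lhat 1 ω = 0
  lhat_succ : ∀ t ∈ Finset.Icc 1 T, ∀ ω,
    lhat (t + 1) ω = lhat t ω + Pi.single (explore t ω)
      (loss t ω (explore t ω) / exploreProb α (η t) (lhat t ω) (rank t ω) (explore t ω))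

namespace FTPLRun

variable {Ω : Type*} [MeasurableSpace Ω] {P : Measure Ω} {K T : ℕ} {α : ℝ} {η : ℕ → ℝ}

/-- The pseudo-regret `E[∑_t ℓ_{t, i_t}] - min_i E[∑_t ℓ_{t, i}]` over the rounds `1, …, T`. -/
noncomputable def pseudoRegret (R : FTPLRun P K T α η) : ℝ :=
  (∫ ω, ∑ t ∈ Finset.Icc 1 T, R.loss t ω (R.exploit t ω) ∂P)
    - ⨅ i : Fin K, ∫ ω, ∑ t ∈ Finset.Icc 1 T, R.loss t ω i ∂P

/-- The stochastically constrained adversarial regime: in every round, whatever the past, the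
expected losses (given the past) of arms `i` and `j` differ by the fixed number `Δ i j`. -/
def IsStochasticallyConstrained (R : FTPLRun P K T α η) (Δ : Fin K → Fin K → ℝ) : Prop :=
  ∀ t ∈ Finset.Icc 1 T, ∀ i j,
    P[fun ω => R.loss t ω i - R.loss t ω j | R.history t] =ᵐ[P] fun _ => Δ i j

end FTPLRun

/-!
Let `w t i` be the probability, given the past, that arm `i` is exploited in round `t`, and let
`L t` be the vector of loss estimates. Comparing the run with the one that plays `w` computed from
`L (t + 1)` instead (be-the-leader, with the expected perturbed minimum as a potential) bounds the
excess of the expected loss over that of the best arm `k` by two sums over the rounds.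

* Penalty: the Pareto tails give `E[r i; i leads] ≲ w t i ^ (1 - 1 / α)`, so the growth of `1 / η`
  costs at most about `K ^ (1 / 2 - 1 / α) / √t * w t i ^ (1 - 1 / α)` for each `i ≠ k`.
* Stability: raising the loss of `i` by `x` lowers its leading probability by at most about
  `η * x * q i ^ 2`, where `q` are the exploration weights. The estimate has size `1 / p i`, so the
  choice `p ∝ q` makes the total `η * (∑ i, q i) ^ 2 ≲ y` with `y = η * K ^ (1 - 1 / α)`. When `k`
  leads with high probability, the weights of the other arms are controlled by `1 - w t k`, which
  improves this to `y * (1 - w t k) ^ (2 / 3)`.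

The excess of a round is the expectation of the sum of `Δ i k * w t i`. By Young's inequality each
of the two terms is at most a quarter of it plus a remainder without `w`, namely
`√K * Δ i k ^ (1 - α) * t ^ (-α / 2)` for each `i ≠ k`, and `min y (y ^ 3 / D ^ 2)` with
`D = min Δ i k`, whose sum over `t` is of order `K / D`. Half of the excess is absorbed.
-/

section Pareto

variable {t r : ℝ}

instance nullSingletonClass_paretoMeasure : NullSingletonClass (paretoMeasure t r) := by
  unfold paretoMeasure; infer_instance

theorem paretoMeasure_Iic_of_le {y : ℝ} (hy : y ≤ t) : paretoMeasure t r (Set.Iic y) = 0 := by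
  rw [measure_congr Iio_ae_eq_Iic.symm, paretoMeasure, withDensity_apply _ measurableSet_Iio]
  exact lintegral_paretoPDF_of_le hy

theorem ae_lt_paretoMeasure (t r : ℝ) : ∀ᵐ x ∂paretoMeasure t r, t < x := by
  simpa [ae_iff, Set.Iic] using paretoMeasure_Iic_of_le (r := r) (le_refl t)

theorem restrict_Ioi_paretoMeasure {y : ℝ} (hy : t ≤ y) :
    (paretoMeasure t r).restrict (Set.Ioi y) = (volume.restrict (Set.Ioi y)).withDensity
      fun x => ENNReal.ofReal (r * t ^ r * x ^ (-(r + 1))) := by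
  rw [paretoMeasure, restrict_withDensity measurableSet_Ioi]
  refine withDensity_congr_ae ?_
  filter_upwards [ae_restrict_mem measurableSet_Ioi] with x hx
  exact paretoPDF_of_le (hy.trans (le_of_lt hx))

theorem setIntegral_Ioi_paretoMeasure (ht : 0 < t) (hr : 0 ≤ r) {y : ℝ} (hy : t ≤ y) (f : ℝ → ℝ) :
    ∫ x in Set.Ioi y, f x ∂(paretoMeasure t r)
      = ∫ x in Set.Ioi y, r * t ^ r * x ^ (-(r + 1)) * f x := by
  rw [restrict_Ioi_paretoMeasure hy, integral_withDensity_eq_integral_toReal_smul (by fun_prop)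
    (ae_of_all _ fun _ => ENNReal.ofReal_lt_top)]
  refine setIntegral_congr_fun measurableSet_Ioi fun x hx => ?_
  have hx0 : 0 < x := ht.trans_le (hy.trans (le_of_lt hx))
  simp only [ENNReal.toReal_ofReal (show 0 ≤ r * t ^ r * x ^ (-(r + 1)) by positivity), smul_eq_mul]

theorem measureReal_Ioi_paretoMeasure (ht : 0 < t) (hr : 0 < r) {y : ℝ} (hy : t ≤ y) :
    (paretoMeasure t r).real (Set.Ioi y) = t ^ r * y ^ (-r) := by
  have h := setIntegral_Ioi_paretoMeasure ht hr.le hy 1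
  simp only [Pi.one_apply, mul_one] at h
  rw [setIntegral_const, smul_eq_mul, mul_one, integral_const_mul,
    integral_Ioi_rpow_of_lt (by linarith) (ht.trans_le hy)] at h
  rw [h, show -(r + 1) + 1 = -r by ring]
  field_simp

theorem setIntegral_id_Ioi_paretoMeasure (ht : 0 < t) (hr : 1 < r) {y : ℝ} (hy : t ≤ y) :
    ∫ x in Set.Ioi y, x ∂(paretoMeasure t r) = r * t ^ r / (r - 1) * y ^ (1 - r) := by
  have hr0 : 1 - r ≠ 0 := by linarith
  have hr1 : r - 1 ≠ 0 := by linarith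
  rw [setIntegral_Ioi_paretoMeasure ht (by linarith) hy, setIntegral_congr_fun
    (g := fun x => r * t ^ r * x ^ (-r)) measurableSet_Ioi, integral_const_mul,
    integral_Ioi_rpow_of_lt (by linarith) (ht.trans_le hy), neg_add_eq_sub]
  · field_simp; ring
  · intro x hx
    have hx0 : x ≠ 0 := (ht.trans (hy.trans_lt hx)).ne'
    simp only [mul_assoc]
    rw [← Real.rpow_add_one hx0, neg_add_rev, neg_add_cancel_comm]

theorem integrable_id_paretoMeasure (ht : 0 < t) (hr : 1 < r) :
    Integrable (fun x : ℝ => x) (paretoMeasure t r) := by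
  have hIoi : IntegrableOn (fun x : ℝ => x) (Set.Ioi t) (paretoMeasure t r) := by
    refine Integrable.of_integral_ne_zero ?_
    rw [setIntegral_id_Ioi_paretoMeasure ht hr le_rfl]
    have : 0 < r - 1 := by linarith
    positivity
  have hself : (paretoMeasure t r).restrict (Set.Ioi t) = paretoMeasure t r :=
    Measure.restrict_eq_self_of_ae_mem (ae_lt_paretoMeasure t r)
  rwa [IntegrableOn, hself] at hIoi

theorem measureReal_Ioi_paretoMeasure_le (ht : 0 < t) (hr : 0 < r) {y z : ℝ} (hz : 0 < z)
    (hzy : z ≤ max t y) : (paretoMeasure t r).real (Set.Ioi y) ≤ t ^ r * z ^ (-r) := by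
  have := isProbabilityMeasure_paretoMeasure ht hr
  calc (paretoMeasure t r).real (Set.Ioi y)
      = (paretoMeasure t r).real (Set.Ioi (max t y)) := by
        refine measureReal_congr ?_
        filter_upwards [ae_lt_paretoMeasure t r] with x hx
        exact propext (max_lt_iff.trans (and_iff_right hx)).symm
    _ = t ^ r * max t y ^ (-r) := measureReal_Ioi_paretoMeasure ht hr (le_max_left t y)
    _ ≤ t ^ r * z ^ (-r) := by
        refine mul_le_mul_of_nonneg_left ?_ (by positivity)
        exact Real.rpow_le_rpow_of_nonpos hz hzy (neg_nonpos.2 hr.le)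

theorem paretoMeasure_Iic_le_exp (ht : 0 < t) (hr : 0 < r) {y : ℝ} :
    paretoMeasure t r (Set.Iic y) ≤ ENNReal.ofReal (Real.exp (-(t ^ r * y ^ (-r)))) := by
  have := isProbabilityMeasure_paretoMeasure ht hr
  rcases le_total y t with hy | hy
  · rw [paretoMeasure_Iic_of_le hy]
    exact zero_le
  · rw [← Set.compl_Ioi, ← ofReal_measureReal, probReal_compl_eq_one_sub measurableSet_Ioi,
      measureReal_Ioi_paretoMeasure ht hr hy]
    exact ENNReal.ofReal_le_ofReal (Real.one_sub_le_exp_neg _)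

theorem paretoMeasure_Ico_le (ht : 0 < t) (hr : 0 ≤ r) {b y : ℝ} (hb : 0 < b) (hby : b ≤ max t y)
    (x : ℝ) : paretoMeasure t r (Set.Ico y (y + x))
      ≤ ENNReal.ofReal (r * t ^ r * b ^ (-(r + 1)) * x) := by
  rw [paretoMeasure, withDensity_apply _ measurableSet_Ico]
  calc ∫⁻ z in Set.Ico y (y + x), paretoPDF t r z
      ≤ ∫⁻ _ in Set.Ico y (y + x), ENNReal.ofReal (r * t ^ r * b ^ (-(r + 1))) := by
        refine setLIntegral_mono measurable_const fun z hz => ?_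
        rcases lt_or_ge z t with h | h
        · rw [paretoPDF_of_lt h]
          exact zero_le
        · rw [paretoPDF_of_le h]
          refine ENNReal.ofReal_le_ofReal (mul_le_mul_of_nonneg_left ?_ (by positivity))
          exact Real.rpow_le_rpow_of_nonpos hb (hby.trans (max_le h hz.1)) (by linarith)
    _ = ENNReal.ofReal (r * t ^ r * b ^ (-(r + 1)) * x) := by
        rw [setLIntegral_const, Real.volume_Ico, ← ENNReal.ofReal_mul (by positivity),
          add_sub_cancel_left]

end Pareto

section Integrals

variable {Ω : Type*} [MeasurableSpace Ω] {μ : Measure Ω} {X : Ω → ℝ}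

theorem setIntegral_le_mul_add_setIntegral_lt [IsFiniteMeasure μ] (hX : Integrable X μ) {b : ℝ}
    (hb : 0 ≤ b) (A : Set Ω) :
    ∫ ω in A, X ω ∂μ ≤ b * μ.real A + ∫ ω in {ω | b < X ω}, X ω ∂μ := by
  have hm : NullMeasurableSet {ω | b < X ω} μ :=
    nullMeasurableSet_lt aemeasurable_const hX.1.aemeasurable
  set Y : Ω → ℝ := {ω | b < X ω}.indicator X with hY
  have hYint : Integrable Y μ := hX.indicator₀ hm
  have hY0 : ∀ ω, 0 ≤ Y ω := Set.indicator_nonneg fun ω hω => hb.trans (le_of_lt hω)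
  calc ∫ ω in A, X ω ∂μ
      ≤ ∫ ω in A, (b + Y ω) ∂μ := by
        refine integral_mono hX.integrableOn
          ((integrable_const b).add hYint).integrableOn fun ω => ?_
        by_cases h : b < X ω
        · simp only [hY, Set.indicator_of_mem (show ω ∈ {ω | b < X ω} from h)]
          linarith
        · simp only [hY, Set.indicator_of_notMem (show ω ∉ {ω | b < X ω} from h)]
          linarith
    _ = b * μ.real A + ∫ ω in A, Y ω ∂μ := by
        rw [integral_add (integrable_const b) hYint.integrableOn, setIntegral_const, smul_eq_mul,
          mul_comm]
    _ ≤ b * μ.real A + ∫ ω, Y ω ∂μ := by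
        gcongr
        · exact ae_of_all _ hY0
        · exact Measure.restrict_le_self
    _ = b * μ.real A + ∫ ω in {ω | b < X ω}, X ω ∂μ := by rw [integral_indicator₀ hm]

/-- The constant `C` in the bound `E[X; A] ≤ C * t * P(A) ^ (1 - 1 / α)` of the expectation, over
an event `A`, of a Pareto variable `X` of scale `t` and shape `α`. -/
noncomputable def paretoTailConst (α : ℝ) : ℝ :=
  1 + α / (α - 1)

theorem paretoTailConst_pos {α : ℝ} (hα : 1 < α) : 0 < paretoTailConst α := by
  have : 0 < α - 1 := sub_pos.2 hα
  unfold paretoTailConst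
  positivity

theorem setIntegral_le_of_hasLaw_paretoMeasure {t r : ℝ} (ht : 0 < t) (hr : 1 < r)
    (hX : HasLaw X (paretoMeasure t r) μ) (A : Set Ω) :
    ∫ ω in A, X ω ∂μ ≤ paretoTailConst r * t * μ.real A ^ (1 - 1 / r) := by
  have hr0 : 0 < r := by linarith
  have := isProbabilityMeasure_paretoMeasure ht hr0
  have : IsProbabilityMeasure μ := hX.isProbabilityMeasure
  have hXint : Integrable X μ := by
    have h := integrable_id_paretoMeasure ht hr
    rw [← hX.map_eq] at h
    exact h.comp_aemeasurable hX.aemeasurable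
  set w := μ.real A with hw
  rcases (measureReal_nonneg (μ := μ) (s := A)).eq_or_lt with h0 | h0
  · have hexp : 0 < 1 - 1 / r := by rw [sub_pos, div_lt_one hr0]; exact hr
    rw [setIntegral_measure_zero _ ((measureReal_eq_zero_iff).1 h0.symm), hw, ← h0,
      Real.zero_rpow hexp.ne', mul_zero]
  -- the truncation level that balances the two terms of `setIntegral_le_mul_add_setIntegral_lt`
  set b := t * w ^ (-(1 / r)) with hb
  have hbt : t ≤ b := le_mul_of_one_le_right ht.le
    (Real.one_le_rpow_of_pos_of_le_one_of_nonpos h0 measureReal_le_one (by simp [hr0.le]))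
  have htail : ∫ ω in {ω | b < X ω}, X ω ∂μ = r * t ^ r / (r - 1) * b ^ (1 - r) := by
    rw [← setIntegral_id_Ioi_paretoMeasure ht hr hbt, ← hX.map_eq]
    exact (setIntegral_map measurableSet_Ioi measurable_id.aestronglyMeasurable
      hX.aemeasurable).symm
  have hbw : b * w = t * w ^ (1 - 1 / r) := by
    rw [hb, mul_assoc, ← Real.rpow_add_one h0.ne', neg_add_eq_sub]
  have hbr : t ^ r * b ^ (1 - r) = t * w ^ (1 - 1 / r) := by
    rw [hb, Real.mul_rpow ht.le (by positivity), ← mul_assoc, ← Real.rpow_add ht,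
      ← Real.rpow_mul h0.le, add_sub_cancel, Real.rpow_one]
    congr 2
    field_simp
    ring
  calc ∫ ω in A, X ω ∂μ
      ≤ b * w + r * t ^ r / (r - 1) * b ^ (1 - r) :=
        htail ▸ setIntegral_le_mul_add_setIntegral_lt hXint (ht.le.trans hbt) A
    _ = b * w + r / (r - 1) * (t ^ r * b ^ (1 - r)) := by ring
    _ = paretoTailConst r * t * w ^ (1 - 1 / r) := by rw [hbw, hbr, paretoTailConst]; ring

theorem lintegral_rpow_le_of_exp_tail (hX0 : 0 ≤ᵐ[μ] X) (hX : AEMeasurable X μ) {n β : ℝ}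
    (hn : 0 < n) (hβ : 0 < β)
    (htail : ∀ s, 0 < s → μ {ω | s < X ω} ≤ ENNReal.ofReal (Real.exp (-(n * s)))) :
    ∫⁻ ω, ENNReal.ofReal (X ω ^ β) ∂μ ≤ ENNReal.ofReal (Real.Gamma (β + 1) * n ^ (-β)) := by
  have integral_eq := Real.integral_rpow_mul_exp_neg_mul_Ioi hβ hn
  have := Real.Gamma_pos_of_pos hβ
  have h_int : IntegrableOn (fun s : ℝ => s ^ (β - 1) * Real.exp (-(n * s))) (Set.Ioi 0) := by
    refine Integrable.of_integral_ne_zero ?_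
    rw [integral_eq]
    positivity
  calc ∫⁻ ω, ENNReal.ofReal (X ω ^ β) ∂μ
      = ENNReal.ofReal β * ∫⁻ s in Set.Ioi 0, μ {ω | s < X ω} * ENNReal.ofReal (s ^ (β - 1)) :=
        lintegral_rpow_eq_lintegral_meas_lt_mul _ hX0 hX hβ
    _ ≤ ENNReal.ofReal β *
          ∫⁻ s in Set.Ioi 0, ENNReal.ofReal (s ^ (β - 1) * Real.exp (-(n * s))) := by
        gcongr ENNReal.ofReal β * ?_
        refine setLIntegral_mono' measurableSet_Ioi fun s (hs : 0 < s) => ?_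
        rw [mul_comm, ENNReal.ofReal_mul (by positivity)]
        gcongr
        exact htail s hs
    _ = ENNReal.ofReal (Real.Gamma (β + 1) * n ^ (-β)) := by
        rw [← ofReal_integral_eq_lintegral_ofReal h_int, integral_eq, ← ENNReal.ofReal_mul hβ.le,
          Real.Gamma_add_one hβ.ne', one_div, Real.inv_rpow hn.le, Real.rpow_neg hn.le]
        · ring_nf
        · filter_upwards [ae_restrict_mem measurableSet_Ioi] with s (hs : 0 < s)
          positivity

end Integrals

section Resampling

variable {ι : Type*} [Fintype ι] [DecidableEq ι] {X : ι → Type*} [∀ i, MeasurableSpace (X i)]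
  {ν : ∀ i, Measure (X i)} [∀ i, IsProbabilityMeasure (ν i)]

theorem lintegral_pi_update {f : (∀ i, X i) → ENNReal} (hf : Measurable f) (i : ι) :
    ∫⁻ r, f r ∂(Measure.pi ν) = ∫⁻ r, ∫⁻ y, f (Function.update r i y) ∂(ν i) ∂(Measure.pi ν) := by
  have marginal_eq : ∀ r, (∫⋯∫⁻_{i}, f ∂ν) r = ∫⁻ y, f (Function.update r i y) ∂(ν i) :=
    fun r => congrFun (lmarginal_singleton f i) r
  simp_rw [← marginal_eq]
  refine lintegral_eq_of_lmarginal_eq {i} hf (hf.lmarginal ν) ?_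
  funext r
  rw [lmarginal_singleton (∫⋯∫⁻_{i}, f ∂ν) i]
  simp [lmarginal_update_of_mem ν (Finset.mem_singleton_self i)]

theorem measure_pi_eq_lintegral_update {A : Set (∀ i, X i)} (hA : MeasurableSet A) (i : ι) :
    Measure.pi ν A = ∫⁻ r, ν i {y | Function.update r i y ∈ A} ∂(Measure.pi ν) := by
  rw [← lintegral_indicator_one hA, lintegral_pi_update (measurable_one.indicator hA) i]
  refine lintegral_congr fun r => ?_
  exact lintegral_indicator_one (measurable_update r hA)

end Resampling

section LeaderSet

variable {ι : Type*}

/-- The perturbation vectors `r` for which the arm `i` is a leader: it minimises `lam i - r i`. -/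
def leaderSet (lam : ι → ℝ) (i : ι) : Set (ι → ℝ) :=
  {r | ∀ k, lam i - r i ≤ lam k - r k}

theorem mem_leaderSet_smul_iff {L r : ι → ℝ} {η : ℝ} (hη : 0 < η) {i : ι} :
    r ∈ leaderSet (η • L) i ↔ ∀ k, L i - r i / η ≤ L k - r k / η := by
  refine forall_congr' fun k => ?_
  have scaled (j : ι) : η * L j - r j = η * (L j - r j / η) := by field_simp
  simp only [Pi.smul_apply, smul_eq_mul, scaled, mul_le_mul_iff_right₀ hη]

theorem exists_mem_leaderSet [Finite ι] [Nonempty ι] (lam r : ι → ℝ) :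
    ∃ i, r ∈ leaderSet lam i :=
  Finite.exists_min (lam - r)

theorem sum_indicator_leaderSet [Fintype ι] {M : Type*} [AddCommMonoid M] {lam r : ι → ℝ}
    (hinj : Function.Injective (lam - r)) {i : ι} (hi : r ∈ leaderSet lam i) (h : ι → M) :
    ∑ k, (leaderSet lam k).indicator (fun _ => h k) r = h i := by
  rw [Finset.sum_eq_single i, Set.indicator_of_mem hi]
  · refine fun k _ hk => Set.indicator_of_notMem (fun hk' : r ∈ leaderSet lam k => ?_) _
    exact hk (hinj (le_antisymm (hk' i) (hi k)))
  · exact fun h => absurd (Finset.mem_univ i) h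

theorem leaderSet_add_single_subset [DecidableEq ι] (lam : ι → ℝ) (i : ι) {x y : ℝ} (hxy : x ≤ y) :
    leaderSet (lam + Pi.single i y) i ⊆ leaderSet (lam + Pi.single i x) i := by
  intro r hr k
  rcases eq_or_ne k i with rfl | hk
  · exact le_rfl
  · have := hr k
    simp only [Pi.add_apply, Pi.single_eq_same, Pi.single_eq_of_ne hk] at this ⊢
    linarith

theorem measurableSet_mem_leaderSet [Countable ι] (i : ι) :
    MeasurableSet {x : (ι → ℝ) × (ι → ℝ) | x.2 ∈ leaderSet x.1 i} := by
  have iInter_eq : {x : (ι → ℝ) × (ι → ℝ) | x.2 ∈ leaderSet x.1 i}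
      = ⋂ k, {x | x.1 i - x.2 i ≤ x.1 k - x.2 k} := by
    ext x; simp [leaderSet]
  rw [iInter_eq]
  exact MeasurableSet.iInter fun k => measurableSet_le (by fun_prop) (by fun_prop)

theorem measurableSet_leaderSet [Countable ι] (lam : ι → ℝ) (i : ι) :
    MeasurableSet (leaderSet lam i) :=
  measurable_prodMk_left (x := lam) (measurableSet_mem_leaderSet i)

theorem ae_injective_sub [Fintype ι] {ν : ι → Measure ℝ} [∀ i, IsProbabilityMeasure (ν i)]
    [∀ i, NullSingletonClass (ν i)] (lam : ι → ℝ) :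
    ∀ᵐ r ∂Measure.pi ν, Function.Injective (lam - r) := by
  classical
  have sub_ne (i k : ι) (hik : i ≠ k) : ∀ᵐ r ∂Measure.pi ν, lam i - r i ≠ lam k - r k := by
    have hA : MeasurableSet {r : ι → ℝ | lam i - r i = lam k - r k} :=
      measurableSet_eq_fun (by fun_prop) (by fun_prop)
    simp only [ae_iff, ne_eq, not_not]
    rw [measure_pi_eq_lintegral_update hA i, lintegral_eq_zero_of_ae_eq_zero]
    refine ae_of_all _ fun r => measure_mono_null (fun y hy => ?_)
      (measure_singleton (μ := ν i) (lam i - (lam k - r k)))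
    simp only [Set.mem_ofPred_eq, Function.update_self, Function.update_of_ne hik.symm] at hy
    simp only [Set.mem_singleton_iff]
    linarith
  simp only [← Filter.eventually_imp_distrib_left, ← ae_all_iff] at sub_ne
  filter_upwards [sub_ne] with r hr i k hik
  exact not_imp_not.1 (hr i k) hik

end LeaderSet

section LeaderProb

variable {ι : Type*} [Fintype ι]

/-- The probability that the arm `i` minimises `lam i - r i`, where the perturbations `r` are
independent with law `ν`. -/
noncomputable def leaderProb (ν : Measure ℝ) (lam : ι → ℝ) (i : ι) : ℝ :=
  (Measure.pi fun _ => ν).real (leaderSet lam i)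

variable {ν : Measure ℝ} (lam : ι → ℝ) (i : ι)

theorem leaderProb_nonneg : 0 ≤ leaderProb ν lam i := measureReal_nonneg

theorem leaderProb_le_one [IsProbabilityMeasure ν] : leaderProb ν lam i ≤ 1 := measureReal_le_one

theorem measurable_leaderProb [SigmaFinite ν] : Measurable fun lam : ι → ℝ => leaderProb ν lam i :=
  (measurable_measure_prodMk_left (measurableSet_mem_leaderSet i)).ennreal_toReal

theorem leaderProb_add_single_antitone [DecidableEq ι] [IsFiniteMeasure ν] :
    Antitone fun x => leaderProb ν (lam + Pi.single i x) i :=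
  fun _ _ hxy => measureReal_mono (leaderSet_add_single_subset lam i hxy)

theorem sum_setIntegral_leaderSet [IsProbabilityMeasure ν] [NullSingletonClass ν]
    {f : (ι → ℝ) → ℝ} (hf : Integrable f (Measure.pi fun _ => ν)) [Nonempty ι] :
    ∑ i, ∫ r in leaderSet lam i, f r ∂(Measure.pi fun _ => ν)
      = ∫ r, f r ∂Measure.pi fun _ => ν := by
  simp only [← integral_indicator (measurableSet_leaderSet lam _)]
  rw [← integral_finsetSum _ fun i _ => hf.indicator (measurableSet_leaderSet lam i)]
  refine integral_congr_ae ?_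
  filter_upwards [ae_injective_sub lam] with r hr
  obtain ⟨i, hi⟩ := exists_mem_leaderSet lam r
  exact sum_indicator_leaderSet hr hi fun _ => f r

theorem sum_leaderProb [IsProbabilityMeasure ν] [NullSingletonClass ν] [Nonempty ι] :
    ∑ i, leaderProb ν lam i = 1 := by
  simpa [leaderProb] using sum_setIntegral_leaderSet (ν := ν) lam (integrable_const (1 : ℝ))

end LeaderProb

section LeaderProbDecrease

variable {ι : Type*}

theorem exists_update_mem_leaderSet_sdiff_subset_Ico [Finite ι] [Nontrivial ι] [DecidableEq ι]
    (lam r : ι → ℝ) (i : ι) (x : ℝ) :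
    ∃ k ≠ i, (∀ j ≠ i, lam i - lam j + r j ≤ lam i - lam k + r k) ∧
      {y | Function.update r i y ∈ leaderSet lam i \ leaderSet (lam + Pi.single i x) i}
        ⊆ Set.Ico (lam i - lam k + r k) (lam i - lam k + r k + x) := by
  obtain ⟨k, hk, hmax⟩ := Set.exists_max_image {i}ᶜ (fun k => lam i - lam k + r k)
    (Set.toFinite _) (exists_ne i)
  refine ⟨k, hk, fun j hj => hmax j hj, fun y hy => ?_⟩
  obtain ⟨hy_mem : ∀ k, _, hy_notMem⟩ := hy
  have hyk := hy_mem k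
  simp only [Function.update_self, Function.update_of_ne hk] at hyk
  refine ⟨by linarith, ?_⟩
  by_contra! hle
  refine hy_notMem fun j => ?_
  rcases eq_or_ne j i with rfl | hj
  · exact le_rfl
  · have hmaxj := hmax j hj
    simp only [Function.update_self, Function.update_of_ne hj, Pi.add_apply, Pi.single_eq_same,
      Pi.single_eq_of_ne hj] at hmaxj ⊢
    linarith

variable [Fintype ι] {i : ι} {lam lam' : ι → ℝ} {x α : ℝ}

theorem leaderProb_sub_le [DecidableEq ι] {ν : Measure ℝ} [IsProbabilityMeasure ν]
    {B : (ι → ℝ) → ENNReal} {C : ℝ} (hC : 0 ≤ C)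
    (hB : ∀ᵐ r ∂Measure.pi fun _ => ν,
      ν {y | Function.update r i y ∈ leaderSet lam i \ leaderSet lam' i} ≤ B r)
    (hBC : ∫⁻ r, B r ∂(Measure.pi fun _ => ν) ≤ ENNReal.ofReal C) :
    leaderProb ν lam i - leaderProb ν lam' i ≤ C := by
  refine (le_measureReal_sdiff (μ := Measure.pi fun _ => ν)).trans
    (ENNReal.toReal_le_of_le_ofReal hC ?_)
  rw [measure_pi_eq_lintegral_update
    ((measurableSet_leaderSet lam i).diff (measurableSet_leaderSet lam' i)) i]
  exact (lintegral_mono_ae hB).trans hBC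

theorem leaderProb_sub_le_of_lintegral_le [Nontrivial ι] [DecidableEq ι] (hα : 0 < α) (hx : 0 ≤ x)
    {b : (ι → ℝ) → ℝ} {C : ℝ} (hC : 0 ≤ C)
    (hb0 : ∀ᵐ r ∂Measure.pi fun _ => paretoMeasure 1 α, 0 < b r)
    (hb : ∀ᵐ r ∂Measure.pi fun _ => paretoMeasure 1 α,
      b r ≤ 1 ∨ ∃ k ≠ i, b r ≤ lam i - lam k + r k)
    (hbC : ∫⁻ r, ENNReal.ofReal (b r ^ (-(α + 1))) ∂(Measure.pi fun _ => paretoMeasure 1 α)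
      ≤ ENNReal.ofReal C) :
    leaderProb (paretoMeasure 1 α) lam i - leaderProb (paretoMeasure 1 α) (lam + Pi.single i x) i
      ≤ α * x * C := by
  have := isProbabilityMeasure_paretoMeasure one_pos hα
  have hαx : 0 ≤ α * x := by positivity
  refine leaderProb_sub_le
    (B := fun r => ENNReal.ofReal (α * x) * ENNReal.ofReal (b r ^ (-(α + 1)))) (by positivity) ?_ ?_
  · filter_upwards [hb0, hb] with r hr0 hr
    obtain ⟨k, -, hmax, hsub⟩ := exists_update_mem_leaderSet_sdiff_subset_Ico lam r i x
    have hbk : b r ≤ max 1 (lam i - lam k + r k) :=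
      le_max_iff.2 (hr.imp_right fun ⟨j, hj, hbj⟩ => hbj.trans (hmax j hj))
    refine (measure_mono hsub).trans ((paretoMeasure_Ico_le one_pos hα.le hr0 hbk x).trans_eq ?_)
    rw [← ENNReal.ofReal_mul hαx, Real.one_rpow, mul_one, mul_right_comm]
  · rw [lintegral_const_mul' _ _ ENNReal.ofReal_ne_top, ENNReal.ofReal_mul hαx]
    gcongr

theorem ae_one_lt_pi_paretoMeasure (hα : 0 < α) :
    ∀ᵐ r ∂Measure.pi fun _ : ι => paretoMeasure 1 α, ∀ k, 1 < r k := by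
  have := isProbabilityMeasure_paretoMeasure one_pos hα
  exact ae_all_iff.2 fun k => Measure.tendsto_eval_ae_ae.eventually (ae_lt_paretoMeasure 1 α)

theorem leaderProb_sub_le_of_gap [Nontrivial ι] [DecidableEq ι] (hα : 0 < α) (hx : 0 ≤ x) {k : ι}
    (hk : lam k ≤ lam i) :
    leaderProb (paretoMeasure 1 α) lam i - leaderProb (paretoMeasure 1 α) (lam + Pi.single i x) i
      ≤ α * x * (1 + (lam i - lam k)) ^ (-(α + 1)) := by
  have := isProbabilityMeasure_paretoMeasure one_pos hα
  have hpos : 0 < 1 + (lam i - lam k) := by linarith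
  refine leaderProb_sub_le_of_lintegral_le (b := fun _ => 1 + (lam i - lam k)) hα hx
    (by positivity) (ae_of_all _ fun _ => hpos) ?_ (by simp)
  filter_upwards [ae_one_lt_pi_paretoMeasure hα] with r hr
  rcases eq_or_ne k i with rfl | hki
  · exact .inl (by simp)
  · exact .inr ⟨k, hki, by linarith [hr k]⟩

theorem measure_pi_forall_le_le_exp (hα : 0 < α) (J : Finset ι) (y : ℝ) :
    (Measure.pi fun _ : ι => paretoMeasure 1 α) {r | ∀ j ∈ J, r j ≤ y}
      ≤ ENNReal.ofReal (Real.exp (-(J.card * y ^ (-α)))) := by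
  have := isProbabilityMeasure_paretoMeasure one_pos hα
  calc (Measure.pi fun _ : ι => paretoMeasure 1 α) {r | ∀ j ∈ J, r j ≤ y}
      = ∏ _j ∈ J, paretoMeasure 1 α (Set.Iic y) :=
        Measure.pi_pi_finset (fun _ : ι => paretoMeasure 1 α) (fun _ => Set.Iic y) J
    _ ≤ ∏ _j ∈ J, ENNReal.ofReal (Real.exp (-(y ^ (-α)))) :=
        Finset.prod_le_prod' fun _ _ => by simpa using paretoMeasure_Iic_le_exp one_pos hα (y := y)
    _ = ENNReal.ofReal (Real.exp (-(J.card * y ^ (-α)))) := by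
        rw [Finset.prod_const, ← ENNReal.ofReal_pow (Real.exp_nonneg _), ← Real.exp_nat_mul,
          mul_neg]

theorem ae_sup'_pos_pi_paretoMeasure (hα : 0 < α) {J : Finset ι} (hJ : J.Nonempty) :
    ∀ᵐ r ∂Measure.pi fun _ : ι => paretoMeasure 1 α, 0 < J.sup' hJ r := by
  filter_upwards [ae_one_lt_pi_paretoMeasure hα] with r hr
  obtain ⟨j, hj⟩ := hJ
  exact (one_pos.trans (hr j)).trans_le (Finset.le_sup' r hj)

theorem lintegral_sup'_rpow_le (hα : 0 < α) {J : Finset ι} (hJ : J.Nonempty) :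
    ∫⁻ r, ENNReal.ofReal (J.sup' hJ r ^ (-(α + 1))) ∂(Measure.pi fun _ => paretoMeasure 1 α)
      ≤ ENNReal.ofReal (Real.Gamma (2 + 1 / α) * (J.card : ℝ) ^ (-(1 + 1 / α))) := by
  have := isProbabilityMeasure_paretoMeasure one_pos hα
  have hsup := ae_sup'_pos_pi_paretoMeasure hα hJ
  have hmeas : Measurable fun r : ι → ℝ => J.sup' hJ r := by
    convert Finset.measurable_sup' hJ fun j _ => measurable_pi_apply (X := fun _ : ι => ℝ) j with r
    rw [Finset.sup'_apply]
  calc ∫⁻ r, ENNReal.ofReal (J.sup' hJ r ^ (-(α + 1))) ∂(Measure.pi fun _ => paretoMeasure 1 α)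
      = ∫⁻ r, ENNReal.ofReal ((J.sup' hJ r ^ (-α)) ^ (1 + 1 / α))
          ∂(Measure.pi fun _ => paretoMeasure 1 α) := by
        refine lintegral_congr_ae ?_
        filter_upwards [hsup] with r hr
        rw [← Real.rpow_mul hr.le]
        congr 2
        field_simp
    _ ≤ ENNReal.ofReal (Real.Gamma (1 + 1 / α + 1) * (J.card : ℝ) ^ (-(1 + 1 / α))) := by
        refine lintegral_rpow_le_of_exp_tail ?_ (hmeas.pow_const _).aemeasurable
          (by exact_mod_cast hJ.card_pos) (by positivity) fun s hs => ?_
        · filter_upwards [hsup] with r hr using Real.rpow_nonneg hr.le _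
        · have hs_eq : (s ^ (-α)⁻¹) ^ (-α) = s := Real.rpow_inv_rpow hs.le (by linarith)
          refine (measure_mono_ae ?_).trans
            ((measure_pi_forall_le_le_exp hα J (s ^ (-α)⁻¹)).trans_eq (by rw [hs_eq]))
          filter_upwards [hsup] with r hr (hsr : s < J.sup' hJ r ^ (-α)) j hj
          refine (Finset.le_sup' r hj).trans ?_
          exact (Real.le_rpow_inv_iff_of_neg hr hs (by linarith)).2 hsr.le
    _ = ENNReal.ofReal (Real.Gamma (2 + 1 / α) * (J.card : ℝ) ^ (-(1 + 1 / α))) := by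
        rw [add_right_comm, one_add_one_eq_two]

theorem leaderProb_sub_le_of_card [Nontrivial ι] [DecidableEq ι] (hα : 0 < α) (hx : 0 ≤ x)
    {J : Finset ι} (hJ : J.Nonempty) (hlam : ∀ j ∈ J, j ≠ i ∧ lam j ≤ lam i) :
    leaderProb (paretoMeasure 1 α) lam i - leaderProb (paretoMeasure 1 α) (lam + Pi.single i x) i
      ≤ α * x * (Real.Gamma (2 + 1 / α) * (J.card : ℝ) ^ (-(1 + 1 / α))) := by
  have := isProbabilityMeasure_paretoMeasure one_pos hα
  refine leaderProb_sub_le_of_lintegral_le (b := J.sup' hJ) hα hx (by positivity)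
    (ae_sup'_pos_pi_paretoMeasure hα hJ) (ae_of_all _ fun r => ?_) (lintegral_sup'_rpow_le hα hJ)
  obtain ⟨j, hj, hsup⟩ := Finset.exists_mem_eq_sup' hJ r
  exact .inr ⟨j, (hlam j hj).1, by linarith [(hlam j hj).2]⟩

theorem measureReal_pi_exists_half_add_lt_le (hα : 0 < α) (s : Finset ι) {g : ι → ℝ}
    (hg : ∀ k, 0 ≤ g k) :
    (Measure.pi fun _ : ι => paretoMeasure 1 α).real (⋃ k ∈ s, {r | 1 / 2 + g k < r k})
      ≤ 2 ^ α * ∑ k ∈ s, (1 + g k) ^ (-α) := by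
  have := isProbabilityMeasure_paretoMeasure one_pos hα
  rw [Finset.mul_sum]
  refine (measureReal_biUnion_finset_le _ _).trans (Finset.sum_le_sum fun k _ => ?_)
  have half_le : (1 + g k) / 2 ≤ max 1 (1 / 2 + g k) := by
    rcases le_total (g k) 1 with h | h
    · exact le_max_of_le_left (by linarith)
    · exact le_max_of_le_right (by linarith)
  calc (Measure.pi fun _ : ι => paretoMeasure 1 α).real {r | 1 / 2 + g k < r k}
      = (paretoMeasure 1 α).real (Set.Ioi (1 / 2 + g k)) :=
        (measurePreserving_eval (fun _ : ι => paretoMeasure 1 α) k).measureReal_preimage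
          measurableSet_Ioi.nullMeasurableSet
    _ ≤ 1 ^ α * ((1 + g k) / 2) ^ (-α) :=
        measureReal_Ioi_paretoMeasure_le one_pos hα (by linarith [hg k]) half_le
    _ = 2 ^ α * (1 + g k) ^ (-α) := by
        rw [Real.one_rpow, one_mul, Real.div_rpow (by linarith [hg k]) zero_le_two,
          Real.rpow_neg zero_le_two, div_inv_eq_mul, mul_comm]

theorem leaderProb_sub_le_of_leader [Nontrivial ι] [DecidableEq ι] (hα : 0 < α) (hx : 0 ≤ x)
    (hx2 : x ≤ 1 / 2) (hlam : ∀ k, lam i ≤ lam k) :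
    leaderProb (paretoMeasure 1 α) lam i - leaderProb (paretoMeasure 1 α) (lam + Pi.single i x) i
      ≤ α * x * (2 ^ α * ∑ k ∈ Finset.univ.erase i, (1 + (lam k - lam i)) ^ (-α)) := by
  have := isProbabilityMeasure_paretoMeasure one_pos hα
  have hαx : 0 ≤ α * x := by positivity
  have hsum : 0 ≤ ∑ k ∈ Finset.univ.erase i, (1 + (lam k - lam i)) ^ (-α) :=
    Finset.sum_nonneg fun k _ => Real.rpow_nonneg (by linarith [hlam k]) _
  let U : Set (ι → ℝ) := ⋃ k ∈ Finset.univ.erase i, {r | 1 / 2 + (lam k - lam i) < r k}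
  have hU : MeasurableSet U := Finset.measurableSet_biUnion _ fun k _ =>
    measurableSet_lt measurable_const (measurable_pi_apply k)
  refine leaderProb_sub_le (B := U.indicator fun _ => ENNReal.ofReal (α * x)) (by positivity)
    (ae_of_all _ fun r => ?_) ?_
  · obtain ⟨k, hk, -, hsub⟩ := exists_update_mem_leaderSet_sdiff_subset_Ico lam r i x
    refine (measure_mono hsub).trans ?_
    rcases le_or_gt (lam i - lam k + r k + x) 1 with h | h
    · refine (measure_mono fun y hy => ?_).trans
        ((paretoMeasure_Iic_of_le (t := 1) (r := α) le_rfl).trans_le zero_le)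
      exact hy.2.le.trans h
    · have hr : r ∈ U := Set.mem_biUnion (by simpa using hk)
        (show 1 / 2 + (lam k - lam i) < r k by linarith)
      rw [Set.indicator_of_mem hr]
      simpa using paretoMeasure_Ico_le one_pos hα.le one_pos (le_max_left 1 _) x
  · rw [lintegral_indicator_const hU, ENNReal.ofReal_mul hαx,
      ← ofReal_measureReal (measure_ne_top _ U)]
    gcongr
    exact measureReal_pi_exists_half_add_lt_le hα _ fun k => sub_nonneg.2 (hlam k)

end LeaderProbDecrease

theorem prod_one_sub_le_inv_one_add_sum {ι : Type*} (s : Finset ι) {b : ι → ℝ}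
    (hb0 : ∀ j ∈ s, 0 ≤ b j) (hb1 : ∀ j ∈ s, b j ≤ 1) :
    ∏ j ∈ s, (1 - b j) ≤ (1 + ∑ j ∈ s, b j)⁻¹ := by
  have hsum : 0 ≤ ∑ j ∈ s, b j := Finset.sum_nonneg hb0
  calc ∏ j ∈ s, (1 - b j)
      ≤ ∏ j ∈ s, Real.exp (-b j) :=
        Finset.prod_le_prod (fun j hj => sub_nonneg.2 (hb1 j hj))
          fun j _ => Real.one_sub_le_exp_neg (b j)
    _ = (Real.exp (∑ j ∈ s, b j))⁻¹ := by
        rw [← Real.exp_sum, Finset.sum_neg_distrib, Real.exp_neg]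
    _ ≤ (1 + ∑ j ∈ s, b j)⁻¹ := by
        gcongr
        rw [add_comm]
        exact Real.add_one_le_exp _

section Leader

variable {ι : Type*} [Fintype ι] {lam : ι → ℝ} {i : ι} {α : ℝ}

theorem measureReal_Iic_mul_one_sub_prod_le_one_sub_leaderProb [DecidableEq ι]
    (ν : Measure ℝ) [IsProbabilityMeasure ν] (lam : ι → ℝ) (i : ι) (z : ℝ) :
    ν.real (Set.Iic z) * (1 - ∏ j ∈ Finset.univ.erase i,
      (1 - ν.real (Set.Ioi (z + (lam j - lam i))))) ≤ 1 - leaderProb ν lam i := by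
  let A : Set (ι → ℝ) := {r | r i ∈ Set.Iic z}
  let Q : Set (ι → ℝ) := Set.univ.pi fun j => Set.Iic (z + (lam j - lam i))
  have hQ : MeasurableSet Q := .univ_pi fun _ => measurableSet_Iic
  have hQA : Q ⊆ A := fun r hr => by simpa [A] using hr i trivial
  have hsub : A \ Q ⊆ (leaderSet lam i)ᶜ := by
    rintro r ⟨hrA : r i ≤ z, hrQ⟩ (hr : ∀ k, _)
    refine hrQ fun j _ => ?_
    rw [Set.mem_Iic]
    linarith [hr j]
  have real_A : (Measure.pi fun _ => ν).real A = ν.real (Set.Iic z) :=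
    (measurePreserving_eval (fun _ : ι => ν) i).measureReal_preimage
      measurableSet_Iic.nullMeasurableSet
  have real_Q : (Measure.pi fun _ => ν).real Q = ν.real (Set.Iic z) *
      ∏ j ∈ Finset.univ.erase i, (1 - ν.real (Set.Ioi (z + (lam j - lam i)))) := by
    rw [measureReal_def, Measure.pi_pi, ENNReal.toReal_prod,
      ← Finset.mul_prod_erase _ _ (Finset.mem_univ i), sub_self, add_zero]
    simp only [← measureReal_def, ← Set.compl_Iic, probReal_compl_eq_one_sub measurableSet_Iic,
      sub_sub_cancel]
  calc ν.real (Set.Iic z) * (1 - ∏ j ∈ Finset.univ.erase i,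
        (1 - ν.real (Set.Ioi (z + (lam j - lam i)))))
      = (Measure.pi fun _ => ν).real (A \ Q) := by
        rw [measureReal_sdiff hQA hQ, real_A, real_Q, mul_sub, mul_one]
    _ ≤ (Measure.pi fun _ => ν).real (leaderSet lam i)ᶜ := measureReal_mono hsub
    _ = 1 - leaderProb ν lam i := probReal_compl_eq_one_sub (measurableSet_leaderSet lam i)

theorem half_mul_one_sub_prod_le_one_sub_leaderProb [DecidableEq ι] (hα : 1 ≤ α) (lam : ι → ℝ)
    (i : ι) :
    1 / 2 * (1 - ∏ j ∈ Finset.univ.erase i,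
        (1 - (paretoMeasure 1 α).real (Set.Ioi (2 + (lam j - lam i)))))
      ≤ 1 - leaderProb (paretoMeasure 1 α) lam i := by
  have hα0 : 0 < α := by linarith
  have := isProbabilityMeasure_paretoMeasure one_pos hα0
  have half_le : 1 / 2 ≤ (paretoMeasure 1 α).real (Set.Iic 2) := by
    have : (2 : ℝ) ^ (-α) ≤ 2 ^ (-1 : ℝ) :=
      Real.rpow_le_rpow_of_exponent_le one_le_two (by linarith)
    rw [Real.rpow_neg_one] at this
    rw [← Set.compl_Ioi, probReal_compl_eq_one_sub measurableSet_Ioi,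
      measureReal_Ioi_paretoMeasure one_pos hα0 one_le_two, Real.one_rpow]
    linarith
  have prod_le_one : ∏ j ∈ Finset.univ.erase i,
      (1 - (paretoMeasure 1 α).real (Set.Ioi (2 + (lam j - lam i)))) ≤ 1 :=
    Finset.prod_le_one (fun _ _ => sub_nonneg.2 measureReal_le_one)
      fun _ _ => sub_le_self _ measureReal_nonneg
  refine le_trans ?_ (measureReal_Iic_mul_one_sub_prod_le_one_sub_leaderProb _ lam i 2)
  exact mul_le_mul_of_nonneg_right half_le (sub_nonneg.2 prod_le_one)

theorem lt_of_one_sub_leaderProb_lt (hα : 1 ≤ α)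
    (hp : 1 - leaderProb (paretoMeasure 1 α) lam i < 2 ^ (-α) / 2) {j : ι} (hj : j ≠ i) :
    lam i < lam j := by
  classical
  have hα0 : 0 < α := by linarith
  have := isProbabilityMeasure_paretoMeasure one_pos hα0
  by_contra! hle
  have le_tail : 2 ^ (-α) ≤ (paretoMeasure 1 α).real (Set.Ioi (2 + (lam j - lam i))) :=
    calc (2 : ℝ) ^ (-α) = (paretoMeasure 1 α).real (Set.Ioi 2) := by
          rw [measureReal_Ioi_paretoMeasure one_pos hα0 one_le_two, Real.one_rpow, one_mul]
      _ ≤ _ := measureReal_mono (Set.Ioi_subset_Ioi (by linarith))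
  have prod_le : ∏ k ∈ Finset.univ.erase i,
        (1 - (paretoMeasure 1 α).real (Set.Ioi (2 + (lam k - lam i))))
      ≤ 1 - (paretoMeasure 1 α).real (Set.Ioi (2 + (lam j - lam i))) := by
    rw [← Finset.mul_prod_erase _ _ (Finset.mem_erase.2 ⟨hj, Finset.mem_univ j⟩)]
    exact mul_le_of_le_one_right (sub_nonneg.2 measureReal_le_one) (Finset.prod_le_one
      (fun _ _ => sub_nonneg.2 measureReal_le_one) fun _ _ => sub_le_self _ measureReal_nonneg)
  linarith [half_mul_one_sub_prod_le_one_sub_leaderProb hα lam i]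

theorem sum_one_add_rpow_le_one_sub_leaderProb [DecidableEq ι] (hα : 1 ≤ α)
    (hlam : ∀ j, lam i ≤ lam j)
    (hp : 1 - leaderProb (paretoMeasure 1 α) lam i ≤ 1 / 6) :
    ∑ j ∈ Finset.univ.erase i, (1 + (lam j - lam i)) ^ (-α)
      ≤ 2 ^ α * (3 * (1 - leaderProb (paretoMeasure 1 α) lam i)) := by
  have hα0 : 0 < α := by linarith
  have := isProbabilityMeasure_paretoMeasure one_pos hα0
  have : 0 ≤ 1 - leaderProb (paretoMeasure 1 α) lam i := sub_nonneg.2 (leaderProb_le_one lam i)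
  set b : ι → ℝ := fun j => (paretoMeasure 1 α).real (Set.Ioi (2 + (lam j - lam i))) with hb
  have hsum0 : 0 ≤ ∑ j ∈ Finset.univ.erase i, b j := Finset.sum_nonneg fun _ _ => measureReal_nonneg
  have sum_le : ∑ j ∈ Finset.univ.erase i, b j
      ≤ 3 * (1 - leaderProb (paretoMeasure 1 α) lam i) := by
    have hle : 1 - 2 * (1 - leaderProb (paretoMeasure 1 α) lam i)
        ≤ (1 + ∑ j ∈ Finset.univ.erase i, b j)⁻¹ := by
      have := prod_one_sub_le_inv_one_add_sum (Finset.univ.erase i) (b := b)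
        (fun _ _ => measureReal_nonneg) fun _ _ => measureReal_le_one
      linarith [half_mul_one_sub_prod_le_one_sub_leaderProb hα lam i]
    rw [inv_eq_one_div, le_div_iff₀ (by linarith)] at hle
    nlinarith
  refine le_trans ?_ (mul_le_mul_of_nonneg_left sum_le (by positivity))
  rw [Finset.mul_sum]
  refine Finset.sum_le_sum fun j _ => ?_
  have hg : 0 ≤ lam j - lam i := sub_nonneg.2 (hlam j)
  calc (1 + (lam j - lam i)) ^ (-α) = 2 ^ α * (2 * (1 + (lam j - lam i))) ^ (-α) := by
        rw [Real.mul_rpow zero_le_two (by linarith), ← mul_assoc, ← Real.rpow_add two_pos,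
          add_neg_cancel, Real.rpow_zero, one_mul]
    _ ≤ 2 ^ α * (2 + (lam j - lam i)) ^ (-α) := by
        gcongr ?_ * ?_
        exact Real.rpow_le_rpow_of_nonpos (by linarith) (by linarith) (by linarith)
    _ = 2 ^ α * b j := by
        rw [hb]
        simp only
        rw [measureReal_Ioi_paretoMeasure one_pos hα0 (by linarith), Real.one_rpow, one_mul]

end Leader

section Ranking

variable {K : ℕ} {L : Fin K → ℝ} {σ : Fin K → ℕ}

namespace IsRanking

theorem one_le (h : IsRanking L σ) (i : Fin K) : 1 ≤ σ i :=
  (h.1.mapsTo (Set.mem_univ i)).1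

theorem ne_and_le_of_lt (h : IsRanking L σ) {i j : Fin K} (hij : σ j < σ i) :
    j ≠ i ∧ L j ≤ L i :=
  ⟨by rintro rfl; exact hij.false, not_lt.1 fun hlt => (h.2 i j hlt).not_gt hij⟩

theorem image_univ (h : IsRanking L σ) : Finset.univ.image σ = Finset.Icc 1 K :=
  Finset.coe_injective (by simpa using h.1.image_eq)

theorem injective (h : IsRanking L σ) : Function.Injective σ :=
  Set.injOn_univ.1 h.1.injOn

theorem sum_comp {M : Type*} [AddCommMonoid M] (h : IsRanking L σ) (f : ℕ → M) :
    ∑ i, f (σ i) = ∑ n ∈ Finset.Icc 1 K, f n := by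
  rw [← h.image_univ, Finset.sum_image h.injective.injOn]

theorem card_filter_lt (h : IsRanking L σ) (i : Fin K) :
    (Finset.univ.filter fun j => σ j < σ i).card = σ i - 1 := by
  have hK : σ i ≤ K := (h.1.mapsTo (Set.mem_univ i)).2
  have filter_eq : (Finset.Icc 1 K).filter (· < σ i) = Finset.Ico 1 (σ i) := by
    ext n; simp only [Finset.mem_filter, Finset.mem_Icc, Finset.mem_Ico]; omega
  have image_filter : (Finset.univ.filter fun j => σ j < σ i).image σ
      = (Finset.univ.image σ).filter (· < σ i) := by rw [Finset.filter_image]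
  rw [← Finset.card_image_of_injective _ h.injective, image_filter, h.image_univ, filter_eq,
    Nat.card_Ico]

theorem eq_one_of_forall_lt (h : IsRanking L σ) {i : Fin K} (hi : ∀ j, j ≠ i → L i < L j) :
    σ i = 1 := by
  have filter_eq : (Finset.univ.filter fun j => σ j < σ i) = ∅ :=
    Finset.filter_eq_empty_iff.2 fun j _ hj =>
      (hi j (h.ne_and_le_of_lt hj).1).not_ge (h.ne_and_le_of_lt hj).2
  have card_eq := h.card_filter_lt i
  rw [filter_eq, Finset.card_empty] at card_eq
  have := h.one_le i
  omega

end IsRanking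

end Ranking

section ExploreWeight

variable {K : ℕ} {α η : ℝ} {L : Fin K → ℝ} {σ : Fin K → ℕ}

theorem lossGap_nonneg (L : Fin K → ℝ) (i : Fin K) : 0 ≤ lossGap L i :=
  sub_nonneg.2 (ciInf_le (Set.finite_range L).bddBelow i)

theorem exists_lossGap_eq (L : Fin K → ℝ) (i : Fin K) : ∃ k, lossGap L i = L i - L k := by
  have : Nonempty (Fin K) := ⟨i⟩
  obtain ⟨k, hk⟩ := exists_eq_ciInf_of_finite (f := L)
  exact ⟨k, by rw [lossGap, hk]⟩

theorem lossGap_eq_of_forall_le {i : Fin K} (hi : ∀ j, L i ≤ L j) (j : Fin K) :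
    lossGap L j = L j - L i := by
  have : Nonempty (Fin K) := ⟨i⟩
  rw [lossGap, le_antisymm (ciInf_le (Set.finite_range L).bddBelow i) (le_ciInf hi)]

theorem one_add_mul_lossGap_pos (hη : 0 ≤ η) (L : Fin K → ℝ) (i : Fin K) :
    0 < 1 + η * lossGap L i := by
  have := mul_nonneg hη (lossGap_nonneg L i)
  linarith

theorem exploreWeight_eq_min (hη : 0 ≤ η) (hα : 0 < α) (i : Fin K) :
    exploreWeight α η L σ i
      = min ((1 + η * lossGap L i) ^ (-((α + 1) / 2))) ((σ i : ℝ) ^ (-((α + 1) / (2 * α)))) := by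
  have hgap := one_add_mul_lossGap_pos hη L i
  have hσ : (0 : ℝ) ≤ (σ i : ℝ) := Nat.cast_nonneg _
  have hexp : (α + 1) / (2 * α) = 1 / α * ((α + 1) / 2) := by field_simp
  rw [exploreWeight, (Real.monotoneOn_rpow_Ici_of_exponent_nonneg (by positivity)).map_min
    (Set.mem_Ici.2 (by positivity)) (Set.mem_Ici.2 (by positivity)), one_div, one_div,
    Real.inv_rpow hgap.le, Real.inv_rpow (by positivity), ← Real.rpow_mul hσ, ← one_div, ← hexp,
    Real.rpow_neg hgap.le, Real.rpow_neg hσ, one_div]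

theorem exploreWeight_sq (hη : 0 ≤ η) (hα : 0 < α) (i : Fin K) :
    exploreWeight α η L σ i ^ 2
      = min ((1 + η * lossGap L i) ^ (-(α + 1))) ((σ i : ℝ) ^ (-(1 + 1 / α))) := by
  have hgap := one_add_mul_lossGap_pos hη L i
  have hσ : (0 : ℝ) ≤ (σ i : ℝ) := Nat.cast_nonneg _
  rw [exploreWeight_eq_min hη hα, pow_left_monotoneOn.map_min (Real.rpow_nonneg hgap.le _)
    (Real.rpow_nonneg hσ _), ← Real.rpow_mul_natCast hgap.le, ← Real.rpow_mul_natCast hσ]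
  congr 2
  · push_cast; ring
  · push_cast; field_simp

theorem exploreWeight_pos (hη : 0 ≤ η) (hσ : IsRanking L σ) (i : Fin K) :
    0 < exploreWeight α η L σ i := by
  have hgap := one_add_mul_lossGap_pos hη L i
  have hσi : (0 : ℝ) < σ i := by exact_mod_cast hσ.one_le i
  exact Real.rpow_pos_of_pos (by positivity) _

theorem rpow_le_rpow_add_mul_sub {p x y : ℝ} (hp0 : 0 ≤ p) (hp1 : p ≤ 1) (hx : 0 ≤ x)
    (hy : 0 < y) : x ^ p ≤ y ^ p + p * y ^ (p - 1) * (x - y) := by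
  have bernoulli : (1 + (x / y - 1)) ^ p ≤ 1 + p * (x / y - 1) :=
    rpow_one_add_le_one_add_mul_self (by have := div_nonneg hx hy.le; linarith) hp0 hp1
  calc x ^ p = y ^ p * (1 + (x / y - 1)) ^ p := by
        rw [← Real.mul_rpow hy.le (by rw [add_sub_cancel]; positivity)]
        congr 1; field_simp; ring
    _ ≤ y ^ p * (1 + p * (x / y - 1)) := by gcongr
    _ = y ^ p + p * y ^ (p - 1) * (x - y) := by rw [Real.rpow_sub_one hy.ne']; field_simp

theorem sum_Icc_rpow_neg_le {s : ℝ} (hs0 : 0 ≤ s) (hs1 : s < 1) (n : ℕ) :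
    ∑ m ∈ Finset.Icc 1 n, (m : ℝ) ^ (-s) ≤ (n : ℝ) ^ (1 - s) / (1 - s) := by
  have hs : 0 < 1 - s := by linarith
  rw [le_div_iff₀ hs]
  induction n with
  | zero => simp [Real.zero_rpow hs.ne']
  | succ n ih =>
    have tangent := rpow_le_rpow_add_mul_sub hs.le (by linarith) n.cast_nonneg
      (Nat.cast_pos.2 n.succ_pos)
    rw [sub_sub_cancel_left] at tangent
    rw [Finset.sum_Icc_succ_top (by omega)]
    push_cast at tangent ⊢
    linarith

theorem sum_exploreWeight_le (hη : 0 ≤ η) (hα : 1 < α) (hσ : IsRanking L σ) :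
    ∑ i, exploreWeight α η L σ i ≤ 2 * α / (α - 1) * (K : ℝ) ^ ((1 - 1 / α) / 2) := by
  have hα0 : 0 < α := by linarith
  have hα1 : α - 1 ≠ 0 := by linarith
  have hs : 1 - (α + 1) / (2 * α) = (1 - 1 / α) / 2 := by field_simp; ring
  calc ∑ i, exploreWeight α η L σ i ≤ ∑ i, (σ i : ℝ) ^ (-((α + 1) / (2 * α))) :=
        Finset.sum_le_sum fun i _ =>
          (exploreWeight_eq_min hη hα0 i).le.trans (min_le_right _ _)
    _ = ∑ n ∈ Finset.Icc 1 K, (n : ℝ) ^ (-((α + 1) / (2 * α))) :=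
        hσ.sum_comp fun n => (n : ℝ) ^ (-((α + 1) / (2 * α)))
    _ ≤ (K : ℝ) ^ (1 - (α + 1) / (2 * α)) / (1 - (α + 1) / (2 * α)) :=
        sum_Icc_rpow_neg_le (by positivity) (by rw [div_lt_one (by positivity)]; linarith) K
    _ = 2 * α / (α - 1) * (K : ℝ) ^ ((1 - 1 / α) / 2) := by rw [hs]; field_simp

/-- The constant relating the decrease of the leading probability of an arm, when its cumulative
loss increases, to the square of its exploration weight. -/
noncomputable def leaderDropConst (α : ℝ) : ℝ :=
  α * (1 + 2 ^ (1 + 1 / α) * Real.Gamma (2 + 1 / α))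

theorem le_leaderDropConst (hα : 0 < α) : α ≤ leaderDropConst α := by
  have := Real.Gamma_pos_of_pos (show 0 < 2 + 1 / α by positivity)
  exact le_mul_of_one_le_right hα.le (le_add_of_nonneg_right (by positivity))

theorem leaderDropConst_pos (hα : 0 < α) : 0 < leaderDropConst α :=
  hα.trans_le (le_leaderDropConst hα)

theorem leaderProb_sub_le_lossGap [Nontrivial (Fin K)] (hα : 0 < α) (hη : 0 ≤ η) (i : Fin K)
    {x : ℝ} (hx : 0 ≤ x) :
    leaderProb (paretoMeasure 1 α) (η • L) i
        - leaderProb (paretoMeasure 1 α) (η • L + Pi.single i x) i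
      ≤ α * x * (1 + η * lossGap L i) ^ (-(α + 1)) := by
  obtain ⟨k, hk⟩ := exists_lossGap_eq L i
  have le_loss : L k ≤ L i := by have := lossGap_nonneg L i; linarith
  simpa [hk, mul_sub] using leaderProb_sub_le_of_gap (lam := η • L) (k := k) hα hx
    (by simpa using mul_le_mul_of_nonneg_left le_loss hη)

theorem leaderProb_sub_le_rank [Nontrivial (Fin K)] (hα : 0 < α) (hη : 0 ≤ η)
    (hσ : IsRanking L σ) (i : Fin K) {x : ℝ} (hx : 0 ≤ x) :
    leaderProb (paretoMeasure 1 α) (η • L) i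
        - leaderProb (paretoMeasure 1 α) (η • L + Pi.single i x) i
      ≤ leaderDropConst α * x * (σ i : ℝ) ^ (-(1 + 1 / α)) := by
  have : 0 < Real.Gamma (2 + 1 / α) := Real.Gamma_pos_of_pos (by positivity)
  rcases (hσ.one_le i).eq_or_lt with hσi | hσi
  · rw [← hσi, Nat.cast_one, Real.one_rpow, mul_one]
    have drop_le := leaderProb_sub_le_of_gap (lam := η • L) (i := i) hα hx le_rfl
    rw [sub_self, add_zero, Real.one_rpow, mul_one] at drop_le
    exact drop_le.trans (mul_le_mul_of_nonneg_right (le_leaderDropConst hα) hx)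
  · set J := Finset.univ.filter fun j => σ j < σ i
    have card_eq : J.card = σ i - 1 := hσ.card_filter_lt i
    have half_le_card : (σ i : ℝ) / 2 ≤ J.card := by
      have : (2 : ℝ) ≤ σ i := by exact_mod_cast hσi
      rw [card_eq, Nat.cast_sub hσi.le, Nat.cast_one]; linarith
    have hσ0 : (0 : ℝ) < σ i := by exact_mod_cast hσ.one_le i
    have card_rpow_le : (J.card : ℝ) ^ (-(1 + 1 / α)) ≤ ((σ i : ℝ) / 2) ^ (-(1 + 1 / α)) :=
      Real.rpow_le_rpow_of_nonpos (by positivity) half_le_card (neg_nonpos.2 (by positivity))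
    calc _ ≤ α * x * (Real.Gamma (2 + 1 / α) * (J.card : ℝ) ^ (-(1 + 1 / α))) := by
          refine leaderProb_sub_le_of_card hα hx (Finset.card_pos.1 (by omega)) fun j hj => ?_
          obtain ⟨hne, hle⟩ := hσ.ne_and_le_of_lt (Finset.mem_filter.1 hj).2
          exact ⟨hne, by simpa using mul_le_mul_of_nonneg_left hle hη⟩
      _ ≤ α * x * (Real.Gamma (2 + 1 / α) * ((σ i : ℝ) / 2) ^ (-(1 + 1 / α))) := by
          gcongr
      _ = (leaderDropConst α - α) * x * (σ i : ℝ) ^ (-(1 + 1 / α)) := by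
          rw [Real.div_rpow hσ0.le zero_le_two, Real.rpow_neg zero_le_two, leaderDropConst]
          field_simp; ring
      _ ≤ leaderDropConst α * x * (σ i : ℝ) ^ (-(1 + 1 / α)) := by gcongr; linarith

theorem leaderProb_sub_le_exploreWeight_sq [Nontrivial (Fin K)] (hα : 0 < α) (hη : 0 ≤ η)
    (hσ : IsRanking L σ) (i : Fin K) {x : ℝ} (hx : 0 ≤ x) :
    leaderProb (paretoMeasure 1 α) (η • L) i
        - leaderProb (paretoMeasure 1 α) (η • L + Pi.single i x) i
      ≤ leaderDropConst α * x * exploreWeight α η L σ i ^ 2 := by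
  have hC : 0 ≤ leaderDropConst α * x := mul_nonneg (leaderDropConst_pos hα).le hx
  have hgap := one_add_mul_lossGap_pos hη L i
  rw [exploreWeight_sq hη hα, mul_min_of_nonneg _ _ hC]
  refine le_min ((leaderProb_sub_le_lossGap hα hη i hx).trans ?_)
    (leaderProb_sub_le_rank hα hη hσ i hx)
  have := le_leaderDropConst hα
  gcongr

end ExploreWeight

section Stability

theorem mul_rpow_le_self_bounding {α A Δ w : ℝ} (hα : 1 < α) (hA : 0 ≤ A) (hΔ : 0 < Δ)
    (hw : 0 ≤ w) :
    A * w ^ (1 - 1 / α) ≤ Δ * w / 4 + 4 ^ (α - 1) * (A ^ α * Δ ^ (1 - α)) := by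
  have hα0 : 0 < α := by linarith
  obtain ⟨z, hz, rfl⟩ : ∃ z, 0 ≤ z ∧ w = z ^ α :=
    ⟨w ^ α⁻¹, by positivity, (Real.rpow_inv_rpow hw hα0.ne').symm⟩
  have rpow_eq : (z ^ α) ^ (1 - 1 / α) = z ^ (α - 1) := by
    rw [← Real.rpow_mul hz]; congr 1; field_simp
  rw [rpow_eq]
  rcases le_or_gt z (4 * A / Δ) with hzA | hzA
  · calc A * z ^ (α - 1) ≤ A * (4 * A / Δ) ^ (α - 1) := by gcongr
      _ = 4 ^ (α - 1) * (A ^ α * Δ ^ (1 - α)) := by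
        have hAα : A ^ α = A * A ^ (α - 1) := by
          rw [← Real.rpow_one_add' hA (by linarith), add_sub_cancel]
        rw [Real.div_rpow (by positivity) hΔ.le, Real.mul_rpow (by norm_num) hA, hAα,
          ← neg_sub α 1, Real.rpow_neg hΔ.le]
        ring
      _ ≤ _ := le_add_of_nonneg_left (by positivity)
  · have hz0 : 0 < z := (by positivity : 0 ≤ 4 * A / Δ).trans_lt hzA
    have hAz : A ≤ Δ * z / 4 := by rw [div_lt_iff₀ hΔ] at hzA; linarith
    calc A * z ^ (α - 1) ≤ Δ * z / 4 * z ^ (α - 1) := by gcongr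
      _ = Δ * z ^ α / 4 := by rw [Real.rpow_sub_one hz0.ne']; field_simp
      _ ≤ _ := le_add_of_nonneg_right (by positivity)

theorem sum_rpow_le_card_rpow_mul {ι : Type*} (s : Finset ι) {a : ι → ℝ} (ha : ∀ i ∈ s, 0 ≤ a i)
    {p : ℝ} (hp0 : 0 < p) (hp1 : p ≤ 1) :
    ∑ i ∈ s, a i ^ p ≤ (s.card : ℝ) ^ (1 - p) * (∑ i ∈ s, a i) ^ p := by
  have hap : ∀ i ∈ s, 0 ≤ a i ^ p := fun i hi => Real.rpow_nonneg (ha i hi) _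
  have sum_nonneg : 0 ≤ ∑ i ∈ s, a i ^ p := Finset.sum_nonneg hap
  have power_mean : (∑ i ∈ s, a i ^ p) ^ p⁻¹ ≤ (s.card : ℝ) ^ (p⁻¹ - 1) * ∑ i ∈ s, a i := by
    refine (Real.rpow_sum_le_const_mul_sum_rpow_of_nonneg s ((one_le_inv₀ hp0).2 hp1) hap).trans_eq
      ?_
    rw [Finset.sum_congr rfl fun i hi => Real.rpow_rpow_inv (ha i hi) hp0.ne']
  calc ∑ i ∈ s, a i ^ p = ((∑ i ∈ s, a i ^ p) ^ p⁻¹) ^ p :=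
        (Real.rpow_inv_rpow sum_nonneg hp0.ne').symm
    _ ≤ ((s.card : ℝ) ^ (p⁻¹ - 1) * ∑ i ∈ s, a i) ^ p := by gcongr
    _ = (s.card : ℝ) ^ (1 - p) * (∑ i ∈ s, a i) ^ p := by
        rw [Real.mul_rpow (by positivity) (Finset.sum_nonneg ha), ← Real.rpow_mul (by positivity),
          sub_mul, one_mul, inv_mul_cancel₀ hp0.ne']

variable {K : ℕ} {α η : ℝ} {L : Fin K → ℝ} {σ : Fin K → ℕ}

/-- The total decrease of the leading probabilities when the cumulative loss of each arm is
increased by its largest possible importance-weighted loss estimate. -/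
noncomputable def stability (α η : ℝ) (L : Fin K → ℝ) (σ : Fin K → ℕ) : ℝ :=
  ∑ i, (leaderProb (paretoMeasure 1 α) (η • L) i
    - leaderProb (paretoMeasure 1 α) (η • L + Pi.single i (η / exploreProb α η L σ i)) i)

theorem sum_exploreWeight_pos [Nonempty (Fin K)] (hη : 0 ≤ η) (hσ : IsRanking L σ) :
    0 < ∑ i, exploreWeight α η L σ i :=
  Finset.sum_pos (fun i _ => exploreWeight_pos hη hσ i) Finset.univ_nonempty

theorem exploreProb_pos (hη : 0 ≤ η) (hσ : IsRanking L σ) (i : Fin K) :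
    0 < exploreProb α η L σ i :=
  have : Nonempty (Fin K) := ⟨i⟩
  div_pos (exploreWeight_pos hη hσ i) (sum_exploreWeight_pos hη hσ)

theorem exploreWeight_eq_one {i : Fin K} (hσ : IsRanking L σ) (hi : ∀ j, j ≠ i → L i < L j) :
    exploreWeight α η L σ i = 1 := by
  have hle : ∀ j, L i ≤ L j := fun j =>
    (eq_or_ne j i).elim (fun h => h ▸ le_rfl) fun h => (hi j h).le
  simp [exploreWeight, lossGap_eq_of_forall_le hle, hσ.eq_one_of_forall_lt hi]

theorem mul_sum_exploreWeight_le [Nonempty (Fin K)] (hα : 1 < α) (hη : 0 ≤ η)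
    (hσ : IsRanking L σ) :
    η * ∑ j, exploreWeight α η L σ j ≤ 2 * α / (α - 1) * (η * (K : ℝ) ^ (1 - 1 / α)) := by
  have : 0 < 2 * α / (α - 1) := div_pos (by linarith) (by linarith)
  have hK : (1 : ℝ) ≤ K := by exact_mod_cast (Classical.arbitrary (Fin K)).pos
  have hexp : 0 ≤ 1 - 1 / α := sub_nonneg.2 ((div_le_one (by linarith)).2 hα.le)
  calc η * ∑ j, exploreWeight α η L σ j
      ≤ η * (2 * α / (α - 1) * (K : ℝ) ^ ((1 - 1 / α) / 2)) := by
        gcongr; exact sum_exploreWeight_le hη hα hσ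
    _ ≤ η * (2 * α / (α - 1) * (K : ℝ) ^ (1 - 1 / α)) := by gcongr; linarith
    _ = _ := by ring

theorem exploreWeight_le_one_add_rpow (hα : 0 < α) (hη : 0 ≤ η) {i : Fin K}
    (hi : ∀ j, L i ≤ L j) (j : Fin K) :
    exploreWeight α η L σ j
      ≤ ((1 + ((η • L) j - (η • L) i)) ^ (-α)) ^ ((α + 1) / (2 * α)) := by
  have gap_eq : (η • L) j - (η • L) i = η * lossGap L j := by
    rw [lossGap_eq_of_forall_le hi, mul_sub, Pi.smul_apply, Pi.smul_apply, smul_eq_mul, smul_eq_mul]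
  refine (exploreWeight_eq_min hη hα j).le.trans ((min_le_left _ _).trans_eq ?_)
  rw [gap_eq, ← Real.rpow_mul (one_add_mul_lossGap_pos hη L j).le]
  congr 1
  field_simp

theorem sum_erase_exploreWeight_le (hα : 1 < α) (hη : 0 ≤ η) {i : Fin K} (hi : ∀ j, L i ≤ L j)
    (hp : 1 - leaderProb (paretoMeasure 1 α) (η • L) i ≤ 1 / 6) :
    ∑ j ∈ Finset.univ.erase i, exploreWeight α η L σ j
      ≤ 3 * 2 ^ α * (K : ℝ) ^ ((1 - 1 / α) / 2)
        * (1 - leaderProb (paretoMeasure 1 α) (η • L) i) ^ ((α + 1) / (2 * α)) := by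
  have hα0 : 0 < α := by linarith
  have := isProbabilityMeasure_paretoMeasure one_pos hα0
  set W := 1 - leaderProb (paretoMeasure 1 α) (η • L) i
  have hW : 0 ≤ W := sub_nonneg.2 (leaderProb_le_one _ _)
  set s := (α + 1) / (2 * α) with hs
  have hs1 : s ≤ 1 := by rw [hs, div_le_one (by positivity)]; linarith
  have hgap : ∀ j, 0 < 1 + ((η • L) j - (η • L) i) := fun j => by
    have := mul_le_mul_of_nonneg_left (hi j) hη
    simp only [Pi.smul_apply, smul_eq_mul]
    linarith
  have card_le : ((Finset.univ.erase i).card : ℝ) ≤ K := by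
    exact_mod_cast (Finset.card_le_univ _).trans_eq (Fintype.card_fin K)
  calc ∑ j ∈ Finset.univ.erase i, exploreWeight α η L σ j
      ≤ ∑ j ∈ Finset.univ.erase i, ((1 + ((η • L) j - (η • L) i)) ^ (-α)) ^ s :=
        Finset.sum_le_sum fun j _ => exploreWeight_le_one_add_rpow hα0 hη hi j
    _ ≤ ((Finset.univ.erase i).card : ℝ) ^ (1 - s)
          * (∑ j ∈ Finset.univ.erase i, (1 + ((η • L) j - (η • L) i)) ^ (-α)) ^ s :=
        sum_rpow_le_card_rpow_mul _ (fun j _ => (Real.rpow_pos_of_pos (hgap j) _).le)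
          (by positivity) hs1
    _ ≤ (K : ℝ) ^ (1 - s) * (2 ^ α * (3 * W)) ^ s := by
        have hsum := sum_one_add_rpow_le_one_sub_leaderProb hα.le
          (fun j => by simpa using mul_le_mul_of_nonneg_left (hi j) hη) hp
        have : 0 ≤ ∑ j ∈ Finset.univ.erase i, (1 + ((η • L) j - (η • L) i)) ^ (-α) :=
          Finset.sum_nonneg fun j _ => (Real.rpow_pos_of_pos (hgap j) _).le
        have : 0 ≤ 1 - s := by linarith
        gcongr
    _ = (3 * 2 ^ α) ^ s * (K : ℝ) ^ ((1 - 1 / α) / 2) * W ^ s := by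
        have hexp : 1 - s = (1 - 1 / α) / 2 := by rw [hs]; field_simp; ring
        rw [← mul_assoc, mul_comm _ (3 : ℝ), Real.mul_rpow (by positivity) hW, hexp]
        ring
    _ ≤ 3 * 2 ^ α * (K : ℝ) ^ ((1 - 1 / α) / 2) * W ^ s := by
        have one_le : (1 : ℝ) ≤ 3 * 2 ^ α := by
          linarith [Real.one_le_rpow one_le_two hα0.le]
        gcongr
        exact Real.rpow_le_self_of_one_le one_le hs1

theorem mul_sum_exploreWeight_mul_sum_erase_le (hα : 1 < α) (hη : 0 ≤ η) (hσ : IsRanking L σ)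
    {i : Fin K} (hi : ∀ j, j ≠ i → L i < L j)
    (hp : 1 - leaderProb (paretoMeasure 1 α) (η • L) i ≤ 1 / 6) :
    η * (∑ j, exploreWeight α η L σ j) * ∑ j ∈ Finset.univ.erase i, exploreWeight α η L σ j
      ≤ (3 * 2 ^ α + (3 * 2 ^ α) ^ 2) * (η * (K : ℝ) ^ (1 - 1 / α))
        * (1 - leaderProb (paretoMeasure 1 α) (η • L) i) ^ ((α + 1) / (2 * α)) := by
  have hα0 : 0 < α := by linarith
  have := isProbabilityMeasure_paretoMeasure one_pos hα0
  have hle : ∀ j, L i ≤ L j := fun j =>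
    (eq_or_ne j i).elim (fun h => h ▸ le_rfl) fun h => (hi j h).le
  have hS := sum_erase_exploreWeight_le (σ := σ) hα hη hle hp
  rw [← Finset.add_sum_erase _ _ (Finset.mem_univ i), exploreWeight_eq_one hσ hi]
  set S := ∑ j ∈ Finset.univ.erase i, exploreWeight α η L σ j
  have hS0 : 0 ≤ S := Finset.sum_nonneg fun j _ => (exploreWeight_pos hη hσ j).le
  set W := 1 - leaderProb (paretoMeasure 1 α) (η • L) i
  have hW : 0 ≤ W := sub_nonneg.2 (leaderProb_le_one _ _)
  set w := W ^ ((α + 1) / (2 * α))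
  have hw1 : w ≤ 1 := Real.rpow_le_one hW (by linarith) (by positivity)
  set k := (K : ℝ) ^ ((1 - 1 / α) / 2)
  have hk : k ^ 2 = (K : ℝ) ^ (1 - 1 / α) := by
    rw [← Real.rpow_mul_natCast (Nat.cast_nonneg K), Nat.cast_ofNat, div_mul_cancel₀ _ two_ne_zero]
  have hkk : k ≤ k ^ 2 := le_self_pow₀ (Real.one_le_rpow (by exact_mod_cast i.pos)
    (div_nonneg (sub_nonneg.2 ((div_le_one hα0).2 hα.le)) zero_le_two)) two_ne_zero
  rw [← hk]
  calc η * (1 + S) * S = η * S + η * (S * S) := by ring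
    _ ≤ η * (3 * 2 ^ α * k ^ 2 * w) + η * (3 * 2 ^ α * k * 1 * (3 * 2 ^ α * k * w)) := by
        gcongr
        · exact hS.trans (by gcongr)
        · exact hS.trans (by gcongr)
    _ = (3 * 2 ^ α + (3 * 2 ^ α) ^ 2) * (η * k ^ 2) * w := by ring

variable [Nontrivial (Fin K)]

theorem leaderProb_sub_le_exploreWeight (hα : 0 < α) (hη : 0 ≤ η) (hσ : IsRanking L σ)
    (i : Fin K) :
    leaderProb (paretoMeasure 1 α) (η • L) i
        - leaderProb (paretoMeasure 1 α) (η • L + Pi.single i (η / exploreProb α η L σ i)) i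
      ≤ leaderDropConst α * (η * ∑ j, exploreWeight α η L σ j) * exploreWeight α η L σ i := by
  have hq := exploreWeight_pos (α := α) hη hσ i
  refine (leaderProb_sub_le_exploreWeight_sq hα hη hσ i
    (div_nonneg hη (exploreProb_pos hη hσ i).le)).trans_eq ?_
  rw [exploreProb]
  field_simp

theorem stability_le (hα : 1 < α) (hη : 0 ≤ η) (hσ : IsRanking L σ) :
    stability α η L σ
      ≤ leaderDropConst α * (2 * α / (α - 1)) ^ 2 * (η * (K : ℝ) ^ (1 - 1 / α)) := by
  have hC := leaderDropConst_pos (zero_lt_one.trans hα)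
  have hQ := sum_exploreWeight_pos (α := α) hη hσ
  set Q := ∑ j, exploreWeight α η L σ j
  calc stability α η L σ ≤ ∑ i, leaderDropConst α * (η * Q) * exploreWeight α η L σ i :=
        Finset.sum_le_sum fun i _ => leaderProb_sub_le_exploreWeight (by linarith) hη hσ i
    _ = leaderDropConst α * (η * Q ^ 2) := by rw [← Finset.mul_sum]; ring
    _ ≤ leaderDropConst α * (η * (2 * α / (α - 1) * (K : ℝ) ^ ((1 - 1 / α) / 2)) ^ 2) := by
        gcongr
        exact sum_exploreWeight_le hη hα hσ
    _ = _ := by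
        rw [mul_pow, ← Real.rpow_mul_natCast (Nat.cast_nonneg K), Nat.cast_ofNat,
          div_mul_cancel₀ _ two_ne_zero]
        ring

/-- The constant in the bound of the stability when one arm is the leader with high probability. -/
noncomputable def leaderStabilityConst (α : ℝ) : ℝ :=
  α * 2 ^ α * (2 * α / (α - 1)) * (3 * 2 ^ α)
    + leaderDropConst α * (3 * 2 ^ α + (3 * 2 ^ α) ^ 2)

theorem leaderStabilityConst_pos (hα : 1 < α) : 0 < leaderStabilityConst α := by
  have : 0 < α - 1 := by linarith
  have := leaderDropConst_pos (zero_lt_one.trans hα)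
  unfold leaderStabilityConst
  positivity

theorem leaderProb_sub_le_one_sub (hα : 1 ≤ α) {lam : Fin K → ℝ} {i : Fin K} {x : ℝ} (hx : 0 ≤ x)
    (hx2 : x ≤ 1 / 2) (hlam : ∀ j, lam i ≤ lam j)
    (hp : 1 - leaderProb (paretoMeasure 1 α) lam i ≤ 1 / 6) :
    leaderProb (paretoMeasure 1 α) lam i - leaderProb (paretoMeasure 1 α) (lam + Pi.single i x) i
      ≤ α * 2 ^ α * (3 * 2 ^ α) * x * (1 - leaderProb (paretoMeasure 1 α) lam i) := by
  refine (leaderProb_sub_le_of_leader (by linarith) hx hx2 hlam).trans ?_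
  calc _ ≤ α * x * (2 ^ α * (2 ^ α * (3 * (1 - leaderProb (paretoMeasure 1 α) lam i)))) := by
        gcongr
        exact sum_one_add_rpow_le_one_sub_leaderProb hα hlam hp
    _ = _ := by ring

theorem stability_le_add_sum_erase (hα : 1 < α) (hη : 0 ≤ η) (hσ : IsRanking L σ) {i : Fin K}
    (hi : ∀ j, j ≠ i → L i < L j)
    (hp : 1 - leaderProb (paretoMeasure 1 α) (η • L) i ≤ 1 / 6)
    (hsmall : η * ∑ j, exploreWeight α η L σ j ≤ 1 / 2) :
    stability α η L σ
      ≤ α * 2 ^ α * (3 * 2 ^ α) * (η * ∑ j, exploreWeight α η L σ j)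
          * (1 - leaderProb (paretoMeasure 1 α) (η • L) i)
        + leaderDropConst α * (η * ∑ j, exploreWeight α η L σ j)
          * ∑ j ∈ Finset.univ.erase i, exploreWeight α η L σ j := by
  have hle : ∀ j, L i ≤ L j := fun j =>
    (eq_or_ne j i).elim (fun h => h ▸ le_rfl) fun h => (hi j h).le
  have hQ := sum_exploreWeight_pos (α := α) hη hσ
  rw [stability, ← Finset.add_sum_erase _ _ (Finset.mem_univ i), Finset.mul_sum _ _ (_ * _)]
  refine add_le_add ?_
    (Finset.sum_le_sum fun j _ => leaderProb_sub_le_exploreWeight (by linarith) hη hσ j)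
  rw [exploreProb, exploreWeight_eq_one hσ hi, div_div_eq_mul_div, div_one]
  exact leaderProb_sub_le_one_sub hα.le (by positivity) hsmall
    (fun j => by simpa using mul_le_mul_of_nonneg_left (hle j) hη) hp

theorem stability_le_of_leader (hα : 1 < α) (hη : 0 ≤ η) (hσ : IsRanking L σ) {i : Fin K}
    (hi : ∀ j, j ≠ i → L i < L j)
    (hp : 1 - leaderProb (paretoMeasure 1 α) (η • L) i ≤ 1 / 6)
    (hsmall : 2 * α / (α - 1) * (η * (K : ℝ) ^ (1 - 1 / α)) ≤ 1 / 2) :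
    stability α η L σ ≤ leaderStabilityConst α * (η * (K : ℝ) ^ (1 - 1 / α))
      * (1 - leaderProb (paretoMeasure 1 α) (η • L) i) ^ ((α + 1) / (2 * α)) := by
  have hα0 : 0 < α := by linarith
  have : 0 < 2 * α / (α - 1) := div_pos (by positivity) (by linarith)
  have hC := leaderDropConst_pos hα0
  have hηQ := mul_sum_exploreWeight_le hα hη hσ
  have hηQS := mul_sum_exploreWeight_mul_sum_erase_le hα hη hσ hi hp
  have hstab := stability_le_add_sum_erase hα hη hσ hi hp (hηQ.trans hsmall)
  have := isProbabilityMeasure_paretoMeasure one_pos hα0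
  set W := 1 - leaderProb (paretoMeasure 1 α) (η • L) i
  have hW : 0 ≤ W := sub_nonneg.2 (leaderProb_le_one _ _)
  have hWs : W ≤ W ^ ((α + 1) / (2 * α)) := Real.self_le_rpow_of_le_one hW (by linarith)
    (by rw [div_le_one (by positivity)]; linarith)
  rw [mul_assoc (leaderDropConst α)] at hstab
  refine hstab.trans ?_
  calc _ ≤ α * 2 ^ α * (3 * 2 ^ α) * (2 * α / (α - 1) * (η * (K : ℝ) ^ (1 - 1 / α)))
          * W ^ ((α + 1) / (2 * α))
        + leaderDropConst α * ((3 * 2 ^ α + (3 * 2 ^ α) ^ 2) * (η * (K : ℝ) ^ (1 - 1 / α))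
          * W ^ ((α + 1) / (2 * α))) := by gcongr
    _ = _ := by rw [leaderStabilityConst]; ring

theorem exists_stability_le_rpow (hα : 1 < α) (hα3 : α ≤ 3) :
    ∃ C > 0, ∀ (K : ℕ) [Nontrivial (Fin K)] (η : ℝ) (L : Fin K → ℝ) (σ : Fin K → ℕ) (i : Fin K),
      0 ≤ η → IsRanking L σ → 2 * α / (α - 1) * (η * (K : ℝ) ^ (1 - 1 / α)) ≤ 1 / 2 →
      stability α η L σ ≤ C * (η * (K : ℝ) ^ (1 - 1 / α))
        * (1 - leaderProb (paretoMeasure 1 α) (η • L) i) ^ (1 - 1 / 3 : ℝ) := by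
  have hα0 : 0 < α := by linarith
  have : 0 < α - 1 := by linarith
  have hC₁ := leaderStabilityConst_pos hα
  have hC₂ : 0 < leaderDropConst α * (2 * α / (α - 1)) ^ 2 :=
    mul_pos (leaderDropConst_pos hα0) (by positivity)
  set C₂ := leaderDropConst α * (2 * α / (α - 1)) ^ 2
  have := isProbabilityMeasure_paretoMeasure one_pos hα0
  refine ⟨leaderStabilityConst α + 16 * C₂, by positivity, fun K _ η L σ i hη hσ hsmall => ?_⟩
  set W := 1 - leaderProb (paretoMeasure 1 α) (η • L) i
  have hW0 : 0 ≤ W := sub_nonneg.2 (leaderProb_le_one _ _)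
  have hW1 : W ≤ 1 := sub_le_self _ (leaderProb_nonneg _ _)
  rcases lt_or_ge W (1 / 16) with hW | hW
  · have threshold : (1 / 16 : ℝ) ≤ 2 ^ (-α) / 2 :=
      calc (1 / 16 : ℝ) = 2 ^ (-3 : ℝ) / 2 := by norm_num
        _ ≤ 2 ^ (-α) / 2 := by gcongr; norm_num
    have hi : ∀ j, j ≠ i → L i < L j := fun j hj => lt_of_mul_lt_mul_left
      (lt_of_one_sub_leaderProb_lt (lam := η • L) hα.le (hW.trans_le threshold) hj) hη
    calc stability α η L σ
        ≤ leaderStabilityConst α * (η * (K : ℝ) ^ (1 - 1 / α)) * W ^ ((α + 1) / (2 * α)) :=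
          stability_le_of_leader hα hη hσ hi (hW.le.trans (by norm_num)) hsmall
      _ ≤ (leaderStabilityConst α + 16 * C₂) * (η * (K : ℝ) ^ (1 - 1 / α))
            * W ^ (1 - 1 / 3 : ℝ) := by
          have hexp : (1 - 1 / 3 : ℝ) ≤ (α + 1) / (2 * α) := by
            rw [le_div_iff₀ (by positivity)]; linarith
          have := Real.rpow_le_rpow_of_exponent_ge_of_imp hW0 hW1 hexp
            fun _ h => absurd h (by positivity)
          gcongr
          linarith
  · have one_le : 1 ≤ 16 * W ^ (1 - 1 / 3 : ℝ) := by
      have := Real.self_le_rpow_of_le_one hW0 hW1 (by norm_num : (1 - 1 / 3 : ℝ) ≤ 1)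
      linarith
    calc stability α η L σ ≤ C₂ * (η * (K : ℝ) ^ (1 - 1 / α)) := stability_le hα hη hσ
      _ ≤ C₂ * (η * (K : ℝ) ^ (1 - 1 / α)) * (16 * W ^ (1 - 1 / 3 : ℝ)) :=
          le_mul_of_one_le_right (by positivity) one_le
      _ = 16 * C₂ * (η * (K : ℝ) ^ (1 - 1 / α)) * W ^ (1 - 1 / 3 : ℝ) := by ring
      _ ≤ _ := by gcongr; linarith

theorem exists_stability_le_cube (hα : 1 < α) (hα3 : α ≤ 3) :
    ∃ C > 0, ∀ (K : ℕ) [Nontrivial (Fin K)] (η : ℝ) (L : Fin K → ℝ) (σ : Fin K → ℕ) (D : ℝ)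
      (i : Fin K), 0 ≤ η → IsRanking L σ → 0 < D → D ≤ 1 →
      stability α η L σ ≤ D * (1 - leaderProb (paretoMeasure 1 α) (η • L) i) / 4
        + C * ((η * (K : ℝ) ^ (1 - 1 / α)) ^ 3 / D ^ 2) := by
  have hα0 : 0 < α := by linarith
  have hA : 0 < 2 * α / (α - 1) := div_pos (by positivity) (by linarith)
  set A := 2 * α / (α - 1)
  have hC₂ : 0 < leaderDropConst α * A ^ 2 := mul_pos (leaderDropConst_pos hα0) (by positivity)
  have := isProbabilityMeasure_paretoMeasure one_pos hα0
  obtain ⟨C, hC, stability_le_rpow⟩ := exists_stability_le_rpow hα hα3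
  refine ⟨leaderDropConst α * A ^ 2 * (2 * A) ^ 2 + 16 * C ^ 3, by positivity,
    fun K _ η L σ D i hη hσ hD hD1 => ?_⟩
  specialize stability_le_rpow K η L σ i hη hσ
  have coarse : stability α η L σ ≤ leaderDropConst α * A ^ 2 * (η * (K : ℝ) ^ (1 - 1 / α)) :=
    stability_le hα hη hσ
  have hy : 0 ≤ η * (K : ℝ) ^ (1 - 1 / α) := by positivity
  set y := η * (K : ℝ) ^ (1 - 1 / α)
  set C₂ := leaderDropConst α * A ^ 2
  set W := 1 - leaderProb (paretoMeasure 1 α) (η • L) i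
  have hW : 0 ≤ W := sub_nonneg.2 (leaderProb_le_one _ _)
  have : 0 ≤ C₂ * (2 * A) ^ 2 * (y ^ 3 / D ^ 2) := by positivity
  have : 0 ≤ 16 * C ^ 3 * (y ^ 3 / D ^ 2) := by positivity
  rcases le_or_gt (A * y) (1 / 2) with hAy | hAy
  · have young : C * y * W ^ (1 - 1 / 3 : ℝ) ≤ D * W / 4 + 16 * C ^ 3 * (y ^ 3 / D ^ 2) := by
      refine (mul_rpow_le_self_bounding (by norm_num) (by positivity) hD hW).trans_eq ?_
      norm_num [mul_pow, Real.rpow_neg hD.le]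
      ring
    linarith [stability_le_rpow hAy]
  · have le_cube : y ≤ (2 * A) ^ 2 * (y ^ 3 / D ^ 2) :=
      calc y = 1 * y := (one_mul y).symm
        _ ≤ (2 * (A * y)) ^ 2 * y := by gcongr; nlinarith
        _ = (2 * A) ^ 2 * y ^ 3 := by ring
        _ ≤ (2 * A) ^ 2 * (y ^ 3 / D ^ 2) := by
          gcongr
          exact le_div_self (by positivity) (by positivity) (pow_le_one₀ hD.le hD1)
    have : 0 ≤ D * W / 4 := by positivity
    linarith [mul_le_mul_of_nonneg_left le_cube hC₂.le]

theorem exists_stability_le (hα : 1 < α) (hα3 : α ≤ 3) :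
    ∃ C > 0, ∀ (K : ℕ) [Nontrivial (Fin K)] (η : ℝ) (L : Fin K → ℝ) (σ : Fin K → ℕ) (D : ℝ)
      (i : Fin K), 0 ≤ η → IsRanking L σ → 0 < D → D ≤ 1 →
      stability α η L σ ≤ D * (1 - leaderProb (paretoMeasure 1 α) (η • L) i) / 4
        + C * min (η * (K : ℝ) ^ (1 - 1 / α)) ((η * (K : ℝ) ^ (1 - 1 / α)) ^ 3 / D ^ 2) := by
  have hα0 : 0 < α := by linarith
  have : 0 < α - 1 := by linarith
  have hC₂ : 0 < leaderDropConst α * (2 * α / (α - 1)) ^ 2 :=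
    mul_pos (leaderDropConst_pos hα0) (by positivity)
  have := isProbabilityMeasure_paretoMeasure one_pos hα0
  obtain ⟨C, -, stability_le_cube⟩ := exists_stability_le_cube hα hα3
  refine ⟨max (leaderDropConst α * (2 * α / (α - 1)) ^ 2) C, by positivity,
    fun K _ η L σ D i hη hσ hD hD1 => ?_⟩
  have hW : 0 ≤ D * (1 - leaderProb (paretoMeasure 1 α) (η • L) i) / 4 :=
    div_nonneg (mul_nonneg hD.le (sub_nonneg.2 (leaderProb_le_one _ _))) (by norm_num)
  rw [mul_min_of_nonneg _ _ (by positivity), ← min_add_add_left]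
  refine le_min ?_ ((stability_le_cube K η L σ D i hη hσ hD hD1).trans ?_)
  · refine (stability_le hα hη hσ).trans (le_add_of_nonneg_of_le hW ?_)
    gcongr
    exact le_max_left _ _
  · gcongr
    exact le_max_right _ _

end Stability

section PerturbedMin

variable {ι : Type*} [Fintype ι] {ν : Measure ℝ}

theorem integrable_sub_mul_apply [IsProbabilityMeasure ν] (hν : Integrable (fun x => x) ν)
    (L : ι → ℝ) (b : ℝ) (i : ι) :
    Integrable (fun r : ι → ℝ => L i - b * r i) (Measure.pi fun _ => ν) :=
  (integrable_const (L i)).sub ((integrable_comp_eval (f := fun x => x) hν).const_mul b)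

theorem sum_setIntegral_leaderSet_sub_integral_le [IsProbabilityMeasure ν] [DecidableEq ι]
    (hν : Integrable (fun x => x) ν) (hν0 : ∀ᵐ x ∂ν, 0 ≤ x)
    (lam : ι → ℝ) (k : ι) :
    ∑ i, ∫ r in leaderSet lam i, r i ∂(Measure.pi fun _ => ν) - ∫ x, x ∂ν
      ≤ ∑ i ∈ Finset.univ.erase k, ∫ r in leaderSet lam i, r i ∂Measure.pi fun _ => ν := by
  have leader_le : ∫ r in leaderSet lam k, r k ∂(Measure.pi fun _ => ν) ≤ ∫ x, x ∂ν := by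
    rw [← integral_comp_eval (μ := fun _ : ι => ν) (i := k) (f := fun x : ℝ => x)
      hν.aestronglyMeasurable]
    exact setIntegral_le_integral (integrable_comp_eval (f := fun x => x) hν)
      ((Measure.tendsto_eval_ae_ae (μ := fun _ => ν) (i := k)).eventually hν0)
  rw [← Finset.add_sum_erase _ _ (Finset.mem_univ k)]
  linarith

theorem setIntegral_leaderSet_paretoMeasure_le {α : ℝ} (hα : 1 < α) (lam : ι → ℝ) (i : ι) :
    ∫ r in leaderSet lam i, r i ∂(Measure.pi fun _ => paretoMeasure 1 α)
      ≤ paretoTailConst α * leaderProb (paretoMeasure 1 α) lam i ^ (1 - 1 / α) := by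
  have := isProbabilityMeasure_paretoMeasure one_pos (one_pos.trans hα)
  have tail_le := setIntegral_le_of_hasLaw_paretoMeasure one_pos hα
    (measurePreserving_eval (fun _ : ι => paretoMeasure 1 α) i).hasLaw (leaderSet lam i)
  rwa [mul_one] at tail_le

variable [Nonempty ι]

/-- The expectation of `min_i (L i - b * r i)`, where the perturbations `r` are independent with
law `ν`; it serves as the potential of follow-the-perturbed-leader. -/
noncomputable def perturbedMin (ν : Measure ℝ) (L : ι → ℝ) (b : ℝ) : ℝ :=
  ∫ r, ⨅ i, (L i - b * r i) ∂Measure.pi fun _ => ν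

theorem integrable_iInf_sub_mul [IsProbabilityMeasure ν] (hν : Integrable (fun x => x) ν)
    (L : ι → ℝ) (b : ℝ) :
    Integrable (fun r : ι → ℝ => ⨅ i, (L i - b * r i)) (Measure.pi fun _ => ν) := by
  refine (integrable_finsetSum Finset.univ fun i _ =>
    (integrable_sub_mul_apply hν L b i).abs).mono'
      (Measurable.iInf fun i => by fun_prop).aestronglyMeasurable (ae_of_all _ fun r => ?_)
  obtain ⟨i, hi⟩ := exists_eq_ciInf_of_finite (f := fun i => L i - b * r i)
  rw [← hi, Real.norm_eq_abs]
  exact Finset.single_le_sum (f := fun i => |L i - b * r i|) (fun k _ => abs_nonneg _)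
    (Finset.mem_univ i)

theorem perturbedMin_le_sub [IsProbabilityMeasure ν] (hν : Integrable (fun x => x) ν)
    (L : ι → ℝ) (b : ℝ) (k : ι) :
    perturbedMin ν L b ≤ L k - b * ∫ x, x ∂ν := by
  calc perturbedMin ν L b ≤ ∫ r, L k - b * r k ∂Measure.pi fun _ => ν :=
        integral_mono (integrable_iInf_sub_mul hν L b) (integrable_sub_mul_apply hν L b k)
          fun r => ciInf_le (Set.finite_range _).bddBelow k
    _ = L k - b * ∫ x, x ∂ν := by
        rw [integral_comp_eval (μ := fun _ => ν) (f := fun x => L k - b * x) (by fun_prop),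
          integral_sub (integrable_const _) (hν.const_mul b), integral_const_mul]
        simp

variable [IsProbabilityMeasure ν] [NullSingletonClass ν]

theorem perturbedMin_le_sum_setIntegral (hν : Integrable (fun x => x) ν) (L : ι → ℝ) (b : ℝ)
    (lam : ι → ℝ) :
    perturbedMin ν L b
      ≤ ∑ i, ∫ r in leaderSet lam i, (L i - b * r i) ∂Measure.pi fun _ => ν := by
  rw [perturbedMin, ← sum_setIntegral_leaderSet lam (integrable_iInf_sub_mul hν L b)]
  refine Finset.sum_le_sum fun i _ => ?_
  refine setIntegral_mono (integrable_iInf_sub_mul hν L b).integrableOn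
    (integrable_sub_mul_apply hν L b i).integrableOn fun r => ?_
  exact ciInf_le (Set.finite_range _).bddBelow i

theorem perturbedMin_inv_eq_sum_setIntegral (hν : Integrable (fun x => x) ν) (L : ι → ℝ) {η : ℝ}
    (hη : 0 < η) :
    perturbedMin ν L η⁻¹
      = ∑ i, ∫ r in leaderSet (η • L) i, (L i - η⁻¹ * r i) ∂Measure.pi fun _ => ν := by
  rw [perturbedMin, ← sum_setIntegral_leaderSet (η • L) (integrable_iInf_sub_mul hν L η⁻¹)]
  refine Finset.sum_congr rfl fun i _ => ?_
  refine setIntegral_congr_fun (measurableSet_leaderSet _ i) fun r hr => ?_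
  refine le_antisymm (ciInf_le (Set.finite_range _).bddBelow i) (le_ciInf fun k => ?_)
  simpa only [inv_mul_eq_div] using (mem_leaderSet_smul_iff hη).1 hr k

theorem sum_sub_mul_leaderProb_le (hν : Integrable (fun x => x) ν) (L L' : ι → ℝ) {η : ℝ}
    (hη : 0 < η) :
    ∑ i, (L' i - L i) * leaderProb ν (η • L') i
      ≤ perturbedMin ν L' η⁻¹ - perturbedMin ν L η⁻¹ := by
  have le_leader := perturbedMin_le_sum_setIntegral hν L η⁻¹ (η • L')
  rw [perturbedMin_inv_eq_sum_setIntegral hν L' hη]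
  refine le_trans (le_of_eq ?_) (sub_le_sub_left le_leader _)
  rw [← Finset.sum_sub_distrib]
  refine Finset.sum_congr rfl fun i _ => ?_
  rw [← integral_sub (integrable_sub_mul_apply hν L' _ i).integrableOn
    (integrable_sub_mul_apply hν L _ i).integrableOn]
  simp [leaderProb, mul_comm]

theorem perturbedMin_le_perturbedMin_inv_add (hν : Integrable (fun x => x) ν) (L : ι → ℝ)
    (b : ℝ) {η : ℝ} (hη : 0 < η) :
    perturbedMin ν L b ≤ perturbedMin ν L η⁻¹
      + (η⁻¹ - b) * ∑ i, ∫ r in leaderSet (η • L) i, r i ∂Measure.pi fun _ => ν := by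
  refine (perturbedMin_le_sum_setIntegral hν L b (η • L)).trans (le_of_eq ?_)
  rw [perturbedMin_inv_eq_sum_setIntegral hν L hη, Finset.mul_sum, ← Finset.sum_add_distrib]
  refine Finset.sum_congr rfl fun i _ => ?_
  have integrable_apply : Integrable (fun r : ι → ℝ => r i) (Measure.pi fun _ => ν) :=
    integrable_comp_eval (f := fun x => x) hν
  rw [← integral_const_mul, ← integral_add (integrable_sub_mul_apply hν L _ i).integrableOn
    (integrable_apply.const_mul _).integrableOn]
  exact integral_congr_ae (ae_of_all _ fun r => by ring)

theorem sum_sum_sub_mul_leaderProb_le_perturbedMin (hν : Integrable (fun x => x) ν) {L : ℕ → ι → ℝ}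
    {η : ℕ → ℝ} {T : ℕ} (hL : L 1 = 0) (hη0 : η 0 = 0) (hη : ∀ t ∈ Finset.Icc 1 T, 0 < η t) :
    ∑ t ∈ Finset.Icc 1 T, ∑ i, (L (t + 1) i - L t i) * leaderProb ν (η t • L (t + 1)) i
      ≤ perturbedMin ν (L (T + 1)) (η T)⁻¹ + ∑ t ∈ Finset.Icc 1 T, ((η t)⁻¹ - (η (t - 1))⁻¹) *
          ∑ i, ∫ r in leaderSet (η t • L t) i, r i ∂Measure.pi fun _ => ν := by
  induction T with
  | zero => simp [perturbedMin, hL, hη0]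
  | succ n ih =>
    have hηn : 0 < η (n + 1) := hη _ (Finset.right_mem_Icc.2 (by lia))
    have previous := ih fun t ht => hη t (Finset.Icc_subset_Icc_right n.le_succ ht)
    have loss_step := sum_sub_mul_leaderProb_le hν (L (n + 1)) (L (n + 2)) hηn
    have rate_step := perturbedMin_le_perturbedMin_inv_add hν (L (n + 1)) (η n)⁻¹ hηn
    rw [Finset.sum_Icc_succ_top (by lia), Finset.sum_Icc_succ_top (by lia), Nat.add_sub_cancel]
    linarith

-- Since `(η 0)⁻¹ = 0`, the increments of `(η t)⁻¹` sum to `(η T)⁻¹`.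
theorem sum_sum_sub_mul_leaderProb_le (hν : Integrable (fun x => x) ν) (hν0 : ∀ᵐ x ∂ν, 0 ≤ x)
    [DecidableEq ι] {L : ℕ → ι → ℝ} {η : ℕ → ℝ} {T : ℕ} (hL : L 1 = 0) (hη0 : η 0 = 0)
    (hη : ∀ t ∈ Finset.Icc 1 T, 0 < η t)
    (hmono : ∀ t ∈ Finset.Icc 1 T, (η (t - 1))⁻¹ ≤ (η t)⁻¹) (k : ι) :
    ∑ t ∈ Finset.Icc 1 T, ∑ i, (L (t + 1) i - L t i) * leaderProb ν (η t • L (t + 1)) i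
      ≤ L (T + 1) k + ∑ t ∈ Finset.Icc 1 T, ((η t)⁻¹ - (η (t - 1))⁻¹) *
          ∑ i ∈ Finset.univ.erase k,
            ∫ r in leaderSet (η t • L t) i, r i ∂Measure.pi fun _ => ν := by
  have telescope : ∑ t ∈ Finset.Icc 1 T, ((η t)⁻¹ - (η (t - 1))⁻¹) = (η T)⁻¹ := by
    rw [← Finset.Ico_add_one_right_eq_Icc, Finset.sum_Ico_eq_sum_range, Nat.add_sub_cancel]
    simp only [add_comm 1, Nat.add_sub_cancel]
    rw [Finset.sum_range_sub fun t => (η t)⁻¹, hη0, inv_zero, sub_zero]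
  calc ∑ t ∈ Finset.Icc 1 T, ∑ i, (L (t + 1) i - L t i) * leaderProb ν (η t • L (t + 1)) i
      ≤ L (T + 1) k - (η T)⁻¹ * ∫ x, x ∂ν + ∑ t ∈ Finset.Icc 1 T, ((η t)⁻¹ - (η (t - 1))⁻¹) *
          ∑ i, ∫ r in leaderSet (η t • L t) i, r i ∂Measure.pi fun _ => ν :=
        (sum_sum_sub_mul_leaderProb_le_perturbedMin hν hL hη0 hη).trans
          (add_le_add_left (perturbedMin_le_sub hν _ _ k) _)
    _ = L (T + 1) k + ∑ t ∈ Finset.Icc 1 T, ((η t)⁻¹ - (η (t - 1))⁻¹) *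
          (∑ i, ∫ r in leaderSet (η t • L t) i, r i ∂(Measure.pi fun _ => ν) - ∫ x, x ∂ν) := by
        simp only [mul_sub, Finset.sum_sub_distrib, ← Finset.sum_mul, telescope]
        ring
    _ ≤ _ := by
        gcongr with t ht
        · exact sub_nonneg.2 (hmono t ht)
        · exact sum_setIntegral_leaderSet_sub_integral_le hν hν0 _ k

variable {α : ℝ} {L : ℕ → ι → ℝ} {η : ℕ → ℝ} {T : ℕ}

theorem sum_sum_sub_mul_leaderProb_paretoMeasure_le [DecidableEq ι] (hα : 1 < α)
    (hL : L 1 = 0) (hη0 : η 0 = 0) (hη : ∀ t ∈ Finset.Icc 1 T, 0 < η t)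
    (hmono : ∀ t ∈ Finset.Icc 1 T, (η (t - 1))⁻¹ ≤ (η t)⁻¹) (k : ι) :
    ∑ t ∈ Finset.Icc 1 T, ∑ i,
        (L (t + 1) i - L t i) * leaderProb (paretoMeasure 1 α) (η t • L (t + 1)) i
      ≤ L (T + 1) k + ∑ t ∈ Finset.Icc 1 T, ((η t)⁻¹ - (η (t - 1))⁻¹) *
          ∑ i ∈ Finset.univ.erase k,
            paretoTailConst α * leaderProb (paretoMeasure 1 α) (η t • L t) i ^ (1 - 1 / α) := by
  have := isProbabilityMeasure_paretoMeasure one_pos (one_pos.trans hα)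
  have pareto_nonneg : ∀ᵐ x ∂paretoMeasure 1 α, 0 ≤ x :=
    (ae_lt_paretoMeasure 1 α).mono fun x hx => zero_le_one.trans hx.le
  refine (sum_sum_sub_mul_leaderProb_le (integrable_id_paretoMeasure one_pos hα) pareto_nonneg
    hL hη0 hη hmono k).trans ?_
  gcongr with t ht i
  · exact sub_nonneg.2 (hmono t ht)
  · exact setIntegral_leaderSet_paretoMeasure_le hα _ i

end PerturbedMin

section SqrtRates

-- The crossover between the two branches of the minimum is at `y = a / D`.
theorem min_div_le_div_mul_sq {a D y : ℝ} (ha : 0 < a) (hD : 0 < D) (hy : 0 < y) :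
    min (a / y) ((a / y) ^ 3 / D ^ 2) ≤ 4 * a ^ 3 / (y * (D * y + a) ^ 2) := by
  have : 0 < D * y := mul_pos hD hy
  rcases le_total (D * y) a with h | h
  · refine (min_le_left _ _).trans ?_
    have sq_le : (D * y + a) ^ 2 ≤ (2 * a) ^ 2 := by gcongr; linarith
    calc a / y = 4 * a ^ 3 / (y * (2 * a) ^ 2) := by field_simp; ring
      _ ≤ 4 * a ^ 3 / (y * (D * y + a) ^ 2) := by gcongr
  · refine (min_le_right _ _).trans ?_
    have sq_le : (D * y + a) ^ 2 ≤ (2 * (D * y)) ^ 2 := by gcongr; linarith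
    calc (a / y) ^ 3 / D ^ 2 = 4 * a ^ 3 / (y * (2 * (D * y)) ^ 2) := by field_simp; ring
      _ ≤ 4 * a ^ 3 / (y * (D * y + a) ^ 2) := by gcongr

theorem min_div_le_sub {a D x y : ℝ} (ha : 0 < a) (hD : 0 < D) (hx : 0 ≤ x) (hy : 0 < y)
    (hxy : y ^ 2 = x ^ 2 + 1) :
    min (a / y) ((a / y) ^ 3 / D ^ 2)
      ≤ 8 * a ^ 2 / D * (D * y / (D * y + a) - D * x / (D * x + a)) := by
  have le : x ≤ y := by nlinarith
  have gap : 1 / (2 * y) ≤ y - x := by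
    rw [div_le_iff₀ (by positivity)]; nlinarith
  calc min (a / y) ((a / y) ^ 3 / D ^ 2) ≤ 4 * a ^ 3 / (y * (D * y + a) ^ 2) :=
        min_div_le_div_mul_sq ha hD hy
    _ = 8 * a ^ 3 * (1 / (2 * y)) / ((D * y + a) * (D * y + a)) := by field_simp; ring
    _ ≤ 8 * a ^ 3 * (y - x) / ((D * y + a) * (D * x + a)) := by gcongr
    _ = 8 * a ^ 2 / D * (D * y / (D * y + a) - D * x / (D * x + a)) := by field_simp; ring

theorem sum_min_div_sqrt_le {a D : ℝ} (ha : 0 < a) (hD : 0 < D) (T : ℕ) :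
    ∑ t ∈ Finset.Icc 1 T, min (a / √t) ((a / √t) ^ 3 / D ^ 2) ≤ 8 * a ^ 2 / D := by
  suffices sum_le : ∑ t ∈ Finset.Icc 1 T, min (a / √t) ((a / √t) ^ 3 / D ^ 2)
      ≤ 8 * a ^ 2 / D * (D * √T / (D * √T + a)) by
    refine sum_le.trans (mul_le_of_le_one_right (by positivity) ?_)
    exact div_le_one_of_le₀ (by linarith) (by positivity)
  induction T with
  | zero => simp
  | succ n ih =>
    have step := min_div_le_sub (x := √n) (y := √(n + 1 : ℕ)) ha hD (Real.sqrt_nonneg _)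
      (Real.sqrt_pos.2 (by positivity))
      (by rw [Real.sq_sqrt (by positivity), Real.sq_sqrt (by positivity)]; push_cast; rfl)
    rw [mul_sub] at step
    rw [Finset.sum_Icc_succ_top (by lia)]
    linarith

theorem sqrt_sub_sqrt_pred_le (t : ℕ) : √t - √(t - 1 : ℕ) ≤ 1 / √t := by
  rcases t with _ | n
  · simp
  · have le : √n ≤ √(n + 1 : ℕ) := Real.sqrt_le_sqrt (by push_cast; linarith)
    have sq_pred := Real.sq_sqrt n.cast_nonneg
    have sq_succ : √(n + 1 : ℕ) ^ 2 = n + 1 := by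
      rw [Real.sq_sqrt (Nat.cast_nonneg _)]; push_cast; rfl
    rw [Nat.add_sub_cancel, le_div_iff₀ (Real.sqrt_pos.2 (by positivity))]
    nlinarith [Real.sqrt_nonneg n]

end SqrtRates

section LearningRate

variable {α c : ℝ} {K : ℕ}

/-- The learning rates `c * K ^ (1 / α - 1 / 2) / √t` of the theorem; the rate of round `0` is
`0`, by division by zero, and so is its inverse. -/
noncomputable def learningRate (α c : ℝ) (K t : ℕ) : ℝ :=
  c * (K : ℝ) ^ (1 / α - 1 / 2) / √t

theorem learningRate_zero : learningRate α c K 0 = 0 := by simp [learningRate]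

theorem learningRate_pos (hc : 0 < c) (hK : 0 < K) {t : ℕ} (ht : 0 < t) :
    0 < learningRate α c K t := by
  unfold learningRate; positivity

theorem inv_learningRate (hK : 0 < K) (t : ℕ) :
    (learningRate α c K t)⁻¹ = (K : ℝ) ^ (1 / 2 - 1 / α) / c * √t := by
  rw [learningRate, inv_div, ← neg_sub (1 / α), Real.rpow_neg (Nat.cast_nonneg K)]
  field_simp

theorem monotone_inv_learningRate (hc : 0 < c) (hK : 0 < K) :
    Monotone fun t => (learningRate α c K t)⁻¹ := fun s t hst => by
  simp only [inv_learningRate hK]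
  gcongr

theorem learningRate_mul_rpow (hK : 0 < K) (t : ℕ) :
    learningRate α c K t * (K : ℝ) ^ (1 - 1 / α) = c * √K / √t := by
  have hK' : (0 : ℝ) < K := by exact_mod_cast hK
  rw [learningRate, div_mul_eq_mul_div, mul_assoc, ← Real.rpow_add hK', Real.sqrt_eq_rpow (K : ℝ)]
  congr 3
  ring

theorem inv_learningRate_sub_le (hc : 0 < c) (hK : 0 < K) (t : ℕ) :
    (learningRate α c K t)⁻¹ - (learningRate α c K (t - 1))⁻¹
      ≤ (K : ℝ) ^ (1 / 2 - 1 / α) / c * (1 / √t) := by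
  rw [inv_learningRate hK, inv_learningRate hK, ← mul_sub]
  gcongr
  exact sqrt_sub_sqrt_pred_le t

theorem inv_learningRate_sub_mul_le (hα : 1 < α) (hα3 : α ≤ 3) (hc : 0 < c) (hK : 0 < K) (t : ℕ)
    {Δ w : ℝ} (hΔ : 0 < Δ) (hw : 0 ≤ w) :
    ((learningRate α c K t)⁻¹ - (learningRate α c K (t - 1))⁻¹) *
        (paretoTailConst α * w ^ (1 - 1 / α))
      ≤ Δ * w / 4 + 4 ^ (α - 1) * (paretoTailConst α / c) ^ α *
          (√K * Δ ^ (1 - α) * (t : ℝ) ^ (-α / 2)) := by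
  have hα0 : 0 < α := by linarith
  have tail_pos := paretoTailConst_pos hα
  have hK' : (1 : ℝ) ≤ K := by exact_mod_cast hK
  set A := paretoTailConst α / c * (K : ℝ) ^ (1 / 2 - 1 / α) * (1 / √t) with hA
  have hA0 : 0 ≤ A := by positivity
  have sqrt_rpow : (1 / √t) ^ α = (t : ℝ) ^ (-α / 2) := by
    rw [Real.sqrt_eq_rpow, one_div, Real.inv_rpow (by positivity),
      ← Real.rpow_mul t.cast_nonneg, ← Real.rpow_neg t.cast_nonneg]
    congr 1; ring
  have rpow_le_sqrt : ((K : ℝ) ^ (1 / 2 - 1 / α)) ^ α ≤ √K := by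
    rw [← Real.rpow_mul (by positivity), Real.sqrt_eq_rpow]
    refine Real.rpow_le_rpow_of_exponent_le hK' ?_
    rw [sub_mul, one_div_mul_cancel hα0.ne']; linarith
  calc _ ≤ (K : ℝ) ^ (1 / 2 - 1 / α) / c * (1 / √t) * (paretoTailConst α * w ^ (1 - 1 / α)) := by
        gcongr
        exact inv_learningRate_sub_le hc hK t
    _ = A * w ^ (1 - 1 / α) := by rw [hA]; ring
    _ ≤ Δ * w / 4 + 4 ^ (α - 1) * (A ^ α * Δ ^ (1 - α)) := mul_rpow_le_self_bounding hα hA0 hΔ hw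
    _ ≤ Δ * w / 4 + 4 ^ (α - 1) *
          ((paretoTailConst α / c) ^ α * √K * (t : ℝ) ^ (-α / 2) * Δ ^ (1 - α)) := by
        rw [hA, Real.mul_rpow (by positivity) (by positivity),
          Real.mul_rpow (by positivity) (by positivity), sqrt_rpow]
        gcongr
    _ = _ := by ring

end LearningRate

section ExploreProb

variable {K : ℕ} {α η : ℝ}

theorem measurable_exploreWeight {X : Type*} {_ : MeasurableSpace X} {L : X → Fin K → ℝ}
    {σ : X → Fin K → ℕ} (hL : Measurable L) (hσ : Measurable σ) (i : Fin K) :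
    Measurable fun x => exploreWeight α η (L x) (σ x) i := by
  have measurable_apply (k : Fin K) : Measurable fun x => L x k := hL.eval
  have measurable_lossGap : Measurable fun x => lossGap (L x) i :=
    (measurable_apply i).sub (Measurable.iInf measurable_apply)
  have measurable_rank : Measurable fun x => (σ x i : ℝ) := measurable_from_top.comp hσ.eval
  unfold exploreWeight
  fun_prop

theorem measurable_exploreProb {X : Type*} {_ : MeasurableSpace X} {L : X → Fin K → ℝ}
    {σ : X → Fin K → ℕ} (hL : Measurable L) (hσ : Measurable σ) (i : Fin K) :
    Measurable fun x => exploreProb α η (L x) (σ x) i :=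
  (measurable_exploreWeight hL hσ i).div
    (Finset.measurable_fun_sum _ fun j _ => measurable_exploreWeight hL hσ j)

theorem exploreWeight_le_one {L : Fin K → ℝ} {σ : Fin K → ℕ} (hη : 0 ≤ η) (hα : 0 < α)
    (i : Fin K) : exploreWeight α η L σ i ≤ 1 := by
  rw [exploreWeight_eq_min hη hα]
  refine (min_le_left _ _).trans (Real.rpow_le_one_of_one_le_of_nonpos ?_ ?_)
  · exact le_add_of_nonneg_right (mul_nonneg hη (lossGap_nonneg L i))
  · rw [neg_nonpos]; positivity

theorem le_exploreWeight {L : Fin K → ℝ} {σ : Fin K → ℕ} {B : ℝ} (hη : 0 ≤ η) (hα : 0 < α)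
    (hσ : IsRanking L σ) (hB : ∀ i, |L i| ≤ B) (i : Fin K) :
    min ((1 + η * (2 * B)) ^ (-((α + 1) / 2))) ((K : ℝ) ^ (-((α + 1) / (2 * α))))
      ≤ exploreWeight α η L σ i := by
  have lossGap_le : lossGap L i ≤ 2 * B := by
    obtain ⟨k, hk⟩ := exists_lossGap_eq L i
    linarith [(abs_le.1 (hB i)).2, (abs_le.1 (hB k)).1]
  have rank_le : (σ i : ℝ) ≤ K := by exact_mod_cast (hσ.1.mapsTo (Set.mem_univ i)).2
  have rank_pos : (0 : ℝ) < σ i := by exact_mod_cast hσ.one_le i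
  rw [exploreWeight_eq_min hη hα]
  refine min_le_min
    (Real.rpow_le_rpow_of_nonpos (one_add_mul_lossGap_pos hη L i) (by gcongr) ?_)
    (Real.rpow_le_rpow_of_nonpos rank_pos rank_le ?_)
  all_goals rw [neg_nonpos]; positivity

theorem exists_le_exploreProb (hα : 0 < α) (hη : 0 ≤ η) (B : ℝ) :
    ∃ p > 0, ∀ (L : Fin K → ℝ) (σ : Fin K → ℕ), (∀ i, |L i| ≤ B) → IsRanking L σ →
      ∀ i, p ≤ exploreProb α η L σ i := by
  rcases isEmpty_or_nonempty (Fin K) with hK | ⟨⟨i₀⟩⟩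
  · exact ⟨1, one_pos, fun L σ _ _ i => (hK.false i).elim⟩
  have hK : (0 : ℝ) < K := by exact_mod_cast i₀.pos
  set q := min ((1 + η * (2 * |B|)) ^ (-((α + 1) / 2))) ((K : ℝ) ^ (-((α + 1) / (2 * α))))
  have : 0 < q := lt_min (by positivity) (by positivity)
  refine ⟨q / K, by positivity, fun L σ hB hσ i => ?_⟩
  have : Nonempty (Fin K) := ⟨i⟩
  have sum_le : ∑ j, exploreWeight α η L σ j ≤ K :=
    (Finset.sum_le_sum fun j _ => exploreWeight_le_one hη hα j).trans (by simp)
  exact div_le_div₀ (exploreWeight_pos hη hσ i).le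
    (le_exploreWeight hη hα hσ (fun j => (hB j).trans (le_abs_self B)) i)
    (sum_exploreWeight_pos hη hσ) sum_le

end ExploreProb

namespace FTPLRun

section Measurability

variable {Ω : Type*} [mΩ : MeasurableSpace Ω] {P : Measure Ω} {K T : ℕ} {α : ℝ} {η : ℕ → ℝ}

/-- The probability of exploring the arm `i` in round `t`, given the past. -/
noncomputable def probExplore (R : FTPLRun P K T α η) (t : ℕ) (ω : Ω) (i : Fin K) : ℝ :=
  exploreProb α (η t) (R.lhat t ω) (R.rank t ω) i

/-- The probability of exploiting the arm `i` in round `t`, given the past. -/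
noncomputable def probExploit (R : FTPLRun P K T α η) (t : ℕ) (ω : Ω) (i : Fin K) : ℝ :=
  leaderProb (paretoMeasure 1 α) (η t • R.lhat t ω) i

/-- The probability with which the arm `i` would be exploited in round `t` if the loss estimates
of round `t` were already included. -/
noncomputable def probHindsight (R : FTPLRun P K T α η) (t : ℕ) (ω : Ω) (i : Fin K) : ℝ :=
  leaderProb (paretoMeasure 1 α) (η t • R.lhat (t + 1) ω) i

/-- The importance-weighted estimate of the loss vector of round `t`. -/
noncomputable def estimate (R : FTPLRun P K T α η) (t : ℕ) (ω : Ω) : Fin K → ℝ :=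
  Pi.single (R.explore t ω) (R.loss t ω (R.explore t ω) / R.probExplore t ω (R.explore t ω))

/-- The information on the past and on the losses of round `t`. -/
@[reducible]
def pastLoss (R : FTPLRun P K T α η) (t : ℕ) : MeasurableSpace Ω :=
  R.history t ⊔ MeasurableSpace.comap (R.loss t) inferInstance

variable (R : FTPLRun P K T α η) {t : ℕ}

theorem lhat_succ_eq_add_estimate (ht : t ∈ Finset.Icc 1 T) (ω : Ω) :
    R.lhat (t + 1) ω = R.lhat t ω + R.estimate t ω :=
  R.lhat_succ t ht ω

theorem lhat_succ_eq_sum_estimate {n : ℕ} (hn : n ≤ T) (ω : Ω) :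
    R.lhat (n + 1) ω = ∑ t ∈ Finset.Icc 1 n, R.estimate t ω := by
  induction n with
  | zero => simp [R.lhat_one]
  | succ n ih =>
    rw [Finset.sum_Icc_succ_top (by lia), ← ih (by lia),
      R.lhat_succ_eq_add_estimate (Finset.mem_Icc.2 ⟨by lia, hn⟩)]

theorem estimate_apply_eq_indicator_observed (t : ℕ) (ω : Ω) (i : Fin K) :
    R.estimate t ω i = (R.explore t ⁻¹' {i}).indicator
      (fun ω => R.loss t ω (R.explore t ω) / R.probExplore t ω i) ω := by
  by_cases h : R.explore t ω = i
  · rw [Set.indicator_of_mem (by simpa using h), estimate, h, Pi.single_eq_same]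
  · rw [Set.indicator_of_notMem (by simpa using h), estimate, Pi.single_eq_of_ne (Ne.symm h)]

theorem estimate_apply_eq_indicator (t : ℕ) (ω : Ω) (i : Fin K) :
    R.estimate t ω i = (R.explore t ⁻¹' {i}).indicator
      (fun ω => R.loss t ω i / R.probExplore t ω i) ω := by
  rw [estimate_apply_eq_indicator_observed]
  exact congrFun (Set.indicator_congr fun ω hω => by rw [Set.mem_singleton_iff.1 hω]) ω

theorem history_le_pastLoss (t : ℕ) : R.history t ≤ R.pastLoss t := le_sup_left

theorem pastLoss_le (ht : t ∈ Finset.Icc 1 T) : R.pastLoss t ≤ mΩ :=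
  sup_le (R.history.le t) (R.measurable_loss t ht).comap_le

theorem measurable_pastLoss_loss_apply (t : ℕ) (i : Fin K) :
    Measurable[R.pastLoss t] fun ω => R.loss t ω i :=
  (measurable_pi_apply i).comp ((comap_measurable (R.loss t)).mono le_sup_right le_rfl)

theorem measurableSet_explore (ht : t ∈ Finset.Icc 1 T) (i : Fin K) :
    MeasurableSet (R.explore t ⁻¹' {i}) :=
  R.history.le _ _ (R.measurable_explore t ht (measurableSet_singleton i))

theorem measurableSet_exploit (ht : t ∈ Finset.Icc 1 T) (i : Fin K) :
    MeasurableSet (R.exploit t ⁻¹' {i}) :=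
  R.history.le _ _ (R.measurable_exploit t ht (measurableSet_singleton i))

theorem measurable_history_lhat (ht1 : 1 ≤ t) (htT : t ≤ T + 1) :
    Measurable[R.history t] (R.lhat t) := by
  induction t, ht1 using Nat.le_induction with
  | base =>
    rw [funext R.lhat_one]
    exact measurable_const
  | succ t ht ih =>
    have htm : t ∈ Finset.Icc 1 T := Finset.mem_Icc.2 ⟨ht, by lia⟩
    have history_mono : R.history t ≤ R.history (t + 1) := R.history.mono (Nat.le_succ t)
    have measurable_lhat : Measurable[R.history (t + 1)] (R.lhat t) :=
      (ih (by lia)).mono history_mono le_rfl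
    have measurable_rank : Measurable[R.history (t + 1)] (R.rank t) :=
      (R.measurable_rank t htm).mono history_mono le_rfl
    refine @measurable_pi_lambda _ _ _ (R.history (t + 1)) _ _ fun i => ?_
    simp only [R.lhat_succ_eq_add_estimate htm, Pi.add_apply,
      R.estimate_apply_eq_indicator_observed]
    refine Measurable.add ((measurable_pi_apply i).comp measurable_lhat) ?_
    refine Measurable.indicator ?_ (R.measurable_explore t htm (measurableSet_singleton i))
    exact (R.measurable_observed t htm).div
      (measurable_exploreProb measurable_lhat measurable_rank i)

theorem measurable_history_smul_lhat (ht : t ∈ Finset.Icc 1 T) :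
    Measurable[R.history t] fun ω => η t • R.lhat t ω := by
  obtain ⟨ht1, htT⟩ := Finset.mem_Icc.1 ht
  exact (measurable_const_smul (η t)).comp (R.measurable_history_lhat ht1 (by lia))

theorem measurable_history_probExplore (ht : t ∈ Finset.Icc 1 T) (i : Fin K) :
    Measurable[R.history t] fun ω => R.probExplore t ω i := by
  obtain ⟨ht1, htT⟩ := Finset.mem_Icc.1 ht
  exact measurable_exploreProb (R.measurable_history_lhat ht1 (by lia)) (R.measurable_rank t ht) i

theorem measurable_pastLoss_loss_div_probExplore (ht : t ∈ Finset.Icc 1 T) (i : Fin K) :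
    Measurable[R.pastLoss t] fun ω => R.loss t ω i / R.probExplore t ω i :=
  (R.measurable_pastLoss_loss_apply t i).div
    ((R.measurable_history_probExplore ht i).mono (R.history_le_pastLoss t) le_rfl)

theorem measurable_history_probExploit (hα : 0 < α) (ht : t ∈ Finset.Icc 1 T) (i : Fin K) :
    Measurable[R.history t] fun ω => R.probExploit t ω i := by
  have := isProbabilityMeasure_paretoMeasure one_pos hα
  exact (measurable_leaderProb i).comp (R.measurable_history_smul_lhat ht)

theorem measurable_probHindsight (hα : 0 < α) (ht : t ∈ Finset.Icc 1 T) (i : Fin K) :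
    Measurable fun ω => R.probHindsight t ω i := by
  have := isProbabilityMeasure_paretoMeasure one_pos hα
  have htT := (Finset.mem_Icc.1 ht).2
  exact (measurable_leaderProb i).comp ((measurable_const_smul (η t)).comp
    ((R.measurable_history_lhat (by lia) (by lia)).mono (R.history.le _) le_rfl))

end Measurability

section Bounds

variable {Ω : Type*} [mΩ : MeasurableSpace Ω] {P : Measure Ω} {K T : ℕ} {α : ℝ} {η : ℕ → ℝ}
  (R : FTPLRun P K T α η) {t : ℕ}

theorem abs_loss_le_one (ht : t ∈ Finset.Icc 1 T) (ω : Ω) (i : Fin K) : |R.loss t ω i| ≤ 1 := by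
  obtain ⟨h0, h1⟩ := R.loss_mem t ht ω i
  rwa [abs_of_nonneg h0]

theorem probExploit_nonneg (t : ℕ) (ω : Ω) (i : Fin K) : 0 ≤ R.probExploit t ω i :=
  leaderProb_nonneg _ i

theorem probExploit_le_one (hα : 0 < α) (t : ℕ) (ω : Ω) (i : Fin K) :
    R.probExploit t ω i ≤ 1 :=
  have := isProbabilityMeasure_paretoMeasure one_pos hα
  leaderProb_le_one _ i

theorem abs_probExploit_le_one (hα : 0 < α) (t : ℕ) (ω : Ω) (i : Fin K) :
    |R.probExploit t ω i| ≤ 1 := by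
  rw [abs_of_nonneg (R.probExploit_nonneg t ω i)]
  exact R.probExploit_le_one hα t ω i

theorem abs_probHindsight_le_one (hα : 0 < α) (t : ℕ) (ω : Ω) (i : Fin K) :
    |R.probHindsight t ω i| ≤ 1 :=
  have := isProbabilityMeasure_paretoMeasure one_pos hα
  (abs_of_nonneg (leaderProb_nonneg _ i)).trans_le (leaderProb_le_one _ i)

theorem sum_probExploit [Nonempty (Fin K)] (hα : 0 < α) (t : ℕ) (ω : Ω) :
    ∑ i, R.probExploit t ω i = 1 :=
  have := isProbabilityMeasure_paretoMeasure one_pos hα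
  sum_leaderProb _

theorem probExplore_pos (ht : t ∈ Finset.Icc 1 T) (hη : 0 ≤ η t) (ω : Ω) (i : Fin K) :
    0 < R.probExplore t ω i :=
  exploreProb_pos hη (R.isRanking t ht ω) i

theorem exists_abs_loss_div_probExplore_le_of_abs_lhat_le (hα : 0 < α) (ht : t ∈ Finset.Icc 1 T)
    (hη : 0 ≤ η t) {B : ℝ} (hB : ∀ ω i, |R.lhat t ω i| ≤ B) :
    ∃ C, ∀ ω i, |R.loss t ω i / R.probExplore t ω i| ≤ C := by
  obtain ⟨p, hp, le_exploreProb⟩ := exists_le_exploreProb (K := K) hα hη B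
  refine ⟨1 / p, fun ω i => ?_⟩
  rw [abs_div, abs_of_pos (R.probExplore_pos ht hη ω i)]
  exact div_le_div₀ zero_le_one (R.abs_loss_le_one ht ω i) hp
    (le_exploreProb _ _ (hB ω) (R.isRanking t ht ω) i)

theorem exists_abs_lhat_le (hα : 0 < α) (hη : ∀ t ∈ Finset.Icc 1 T, 0 < η t) (ht1 : 1 ≤ t)
    (htT : t ≤ T) : ∃ B, ∀ ω i, |R.lhat t ω i| ≤ B := by
  induction t, ht1 using Nat.le_induction with
  | base => exact ⟨0, fun ω i => by simp [R.lhat_one]⟩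
  | succ t ht ih =>
    have htm : t ∈ Finset.Icc 1 T := Finset.mem_Icc.2 ⟨ht, by lia⟩
    obtain ⟨B, hB⟩ := ih (by lia)
    obtain ⟨C, hC⟩ :=
      R.exists_abs_loss_div_probExplore_le_of_abs_lhat_le hα htm (hη t htm).le hB
    refine ⟨B + C, fun ω i => ?_⟩
    rw [R.lhat_succ_eq_add_estimate htm, Pi.add_apply, R.estimate_apply_eq_indicator]
    have estimate_le : ‖(R.explore t ⁻¹' {i}).indicator
        (fun ω => R.loss t ω i / R.probExplore t ω i) ω‖ ≤ C :=
      (norm_indicator_le_norm_self _ ω).trans (hC ω i)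
    exact (abs_add_le _ _).trans (add_le_add (hB ω i) estimate_le)

theorem exists_abs_loss_div_probExplore_le (hα : 0 < α) (hη : ∀ t ∈ Finset.Icc 1 T, 0 < η t)
    (ht : t ∈ Finset.Icc 1 T) : ∃ C, ∀ ω i, |R.loss t ω i / R.probExplore t ω i| ≤ C := by
  obtain ⟨ht1, htT⟩ := Finset.mem_Icc.1 ht
  obtain ⟨B, hB⟩ := R.exists_abs_lhat_le hα hη ht1 htT
  exact R.exists_abs_loss_div_probExplore_le_of_abs_lhat_le hα ht (hη t ht).le hB

end Bounds

section Integrability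

variable {Ω : Type*} [mΩ : MeasurableSpace Ω] {P : Measure Ω} [IsProbabilityMeasure P] {K T : ℕ}
  {α : ℝ} {η : ℕ → ℝ} (R : FTPLRun P K T α η) {t : ℕ}

theorem integrable_loss_apply (ht : t ∈ Finset.Icc 1 T) (i : Fin K) :
    Integrable (fun ω => R.loss t ω i) P :=
  Integrable.of_bound (R.measurable_loss t ht).eval.aestronglyMeasurable 1
    (ae_of_all _ fun ω => R.abs_loss_le_one ht ω i)

theorem integrable_probExploit (hα : 0 < α) (ht : t ∈ Finset.Icc 1 T) (i : Fin K) :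
    Integrable (fun ω => R.probExploit t ω i) P :=
  Integrable.of_bound
    ((R.measurable_history_probExploit hα ht i).mono (R.history.le t) le_rfl).aestronglyMeasurable
    1 (ae_of_all _ fun ω => R.abs_probExploit_le_one hα t ω i)

theorem integrable_probExploit_rpow (hα : 0 < α) (ht : t ∈ Finset.Icc 1 T) (i : Fin K) {s : ℝ}
    (hs : 0 ≤ s) : Integrable (fun ω => R.probExploit t ω i ^ s) P := by
  refine Integrable.of_bound ((R.integrable_probExploit hα ht i).aemeasurable.pow_const
    s).aestronglyMeasurable 1 (ae_of_all _ fun ω => ?_)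
  rw [Real.norm_of_nonneg (Real.rpow_nonneg (R.probExploit_nonneg t ω i) _)]
  exact Real.rpow_le_one (R.probExploit_nonneg t ω i) (R.probExploit_le_one hα t ω i) hs

theorem integrable_loss_mul_probExploit (hα : 0 < α) (ht : t ∈ Finset.Icc 1 T) (i j : Fin K) :
    Integrable (fun ω => R.loss t ω i * R.probExploit t ω j) P :=
  (R.integrable_probExploit hα ht j).bdd_mul (R.integrable_loss_apply ht i).aestronglyMeasurable
    (ae_of_all _ fun ω => R.abs_loss_le_one ht ω i)

theorem integrable_estimate (hα : 0 < α) (hη : ∀ t ∈ Finset.Icc 1 T, 0 < η t)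
    (ht : t ∈ Finset.Icc 1 T) (i : Fin K) : Integrable (fun ω => R.estimate t ω i) P := by
  obtain ⟨C, hC⟩ := R.exists_abs_loss_div_probExplore_le hα hη ht
  simp only [R.estimate_apply_eq_indicator]
  refine Integrable.indicator ?_ (R.measurableSet_explore ht i)
  exact Integrable.of_bound ((R.measurable_pastLoss_loss_div_probExplore ht i).mono
    (R.pastLoss_le ht) le_rfl).aestronglyMeasurable C (ae_of_all _ fun ω => hC ω i)

theorem integrable_estimate_mul_probExploit (hα : 0 < α) (hη : ∀ t ∈ Finset.Icc 1 T, 0 < η t)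
    (ht : t ∈ Finset.Icc 1 T) (i : Fin K) :
    Integrable (fun ω => R.estimate t ω i * R.probExploit t ω i) P :=
  (R.integrable_estimate hα hη ht i).mul_bdd (R.integrable_probExploit hα ht i).aestronglyMeasurable
    (ae_of_all _ fun ω => R.abs_probExploit_le_one hα t ω i)

theorem integrable_estimate_mul_probHindsight (hα : 0 < α) (hη : ∀ t ∈ Finset.Icc 1 T, 0 < η t)
    (ht : t ∈ Finset.Icc 1 T) (i : Fin K) :
    Integrable (fun ω => R.estimate t ω i * R.probHindsight t ω i) P :=
  (R.integrable_estimate hα hη ht i).mul_bdd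
    (R.measurable_probHindsight hα ht i).aestronglyMeasurable
    (ae_of_all _ fun ω => R.abs_probHindsight_le_one hα t ω i)

end Integrability

end FTPLRun

section Independence

variable {Ω ι : Type*} [MeasurableSpace Ω] {P : Measure Ω} [IsFiniteMeasure P] [Fintype ι]
  {ν : Measure ℝ} [IsProbabilityMeasure ν]

theorem integral_indicator_mem_leaderSet {X L : Ω → ι → ℝ} {Y : Ω → ℝ} (hX : AEMeasurable X P)
    (hL : AEMeasurable L P) (hY : Integrable Y P) (map_X : P.map X = Measure.pi fun _ => ν)
    (hindep : IndepFun (fun ω => (Y ω, L ω)) X P) (i : ι) :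
    ∫ ω, {ω | X ω ∈ leaderSet (L ω) i}.indicator Y ω ∂P
      = ∫ ω, Y ω * leaderProb ν (L ω) i ∂P := by
  set Z : Ω → ℝ × (ι → ℝ) := fun ω => (Y ω, L ω)
  set f : (ℝ × (ι → ℝ)) × (ι → ℝ) → ℝ :=
    {x | x.2 ∈ leaderSet x.1.2 i}.indicator fun x => x.1.1
  have hZ : AEMeasurable Z P := hY.aemeasurable.prodMk hL
  have map_eq : P.map (fun ω => (Z ω, X ω)) = (P.map Z).prod (Measure.pi fun _ => ν) := by
    rw [(indepFun_iff_map_prod_eq_prod_map_map hZ hX).1 hindep, map_X]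
  have measurable_f : Measurable f := by
    refine (measurable_fst.comp measurable_fst).indicator ?_
    exact (measurable_snd.comp measurable_fst).prodMk measurable_snd (measurableSet_mem_leaderSet i)
  have integrable_f : Integrable f ((P.map Z).prod (Measure.pi fun _ => ν)) := by
    rw [← map_eq, integrable_map_measure measurable_f.aestronglyMeasurable (hZ.prodMk hX)]
    exact hY.mono (measurable_f.comp_aemeasurable (hZ.prodMk hX)).aestronglyMeasurable
      (ae_of_all _ fun ω => norm_indicator_le_norm_self (fun x => x.1.1) (Z ω, X ω))
  calc ∫ ω, {ω | X ω ∈ leaderSet (L ω) i}.indicator Y ω ∂P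
      = ∫ x, f x ∂((P.map Z).prod (Measure.pi fun _ => ν)) := by
        rw [← map_eq, integral_map (hZ.prodMk hX) measurable_f.aestronglyMeasurable]
        rfl
    _ = ∫ z, ∫ r, f (z, r) ∂(Measure.pi fun _ => ν) ∂(P.map Z) := integral_prod _ integrable_f
    _ = ∫ z, z.1 * leaderProb ν z.2 i ∂(P.map Z) := by
        refine integral_congr_ae (ae_of_all _ fun z => ?_)
        exact (integral_indicator_const z.1 (measurableSet_leaderSet z.2 i)).trans (mul_comm _ _)
    _ = ∫ ω, Y ω * leaderProb ν (L ω) i ∂P :=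
        integral_map hZ (measurable_fst.mul
          ((measurable_leaderProb i).comp measurable_snd)).aestronglyMeasurable

end Independence

namespace FTPLRun

section Expectation

variable {Ω : Type*} [mΩ : MeasurableSpace Ω] {P : Measure Ω} [IsProbabilityMeasure P] {K T : ℕ}
  {α : ℝ} {η : ℕ → ℝ} (R : FTPLRun P K T α η) {t : ℕ}

theorem integral_indicator_exploit_loss_le (hα : 0 < α) (ht : t ∈ Finset.Icc 1 T) (hη : 0 < η t)
    (i : Fin K) :
    ∫ ω, (R.exploit t ⁻¹' {i}).indicator (fun ω => R.loss t ω i) ω ∂P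
      ≤ ∫ ω, R.loss t ω i * R.probExploit t ω i ∂P := by
  have := isProbabilityMeasure_paretoMeasure one_pos hα
  have measurable_lhat := R.measurable_history_smul_lhat ht
  have measurable_pert : Measurable (R.pert t) :=
    (R.measurable_pert t ht).mono (R.history.le _) le_rfl
  have indep : IndepFun (fun ω => (R.loss t ω i, η t • R.lhat t ω)) (R.pert t) P := by
    rw [IndepFun_iff_Indep]
    refine indep_of_indep_of_le_left (R.indep_pert t ht).symm (Measurable.comap_le ?_)
    exact (R.measurable_pastLoss_loss_apply t i).prodMk
      (measurable_lhat.mono (R.history_le_pastLoss t) le_rfl)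
  have subset_leaderSet :
      R.exploit t ⁻¹' {i} ⊆ {ω | R.pert t ω ∈ leaderSet (η t • R.lhat t ω) i} := by
    rintro ω rfl
    exact (mem_leaderSet_smul_iff hη).2 (R.exploit_argmin t ht ω)
  have loss_nonneg (ω : Ω) : 0 ≤ R.loss t ω i := (R.loss_mem t ht ω i).1
  have measurableSet_leader :
      MeasurableSet {ω | R.pert t ω ∈ leaderSet (η t • R.lhat t ω) i} :=
    (measurable_lhat.mono (R.history.le t) le_rfl).prodMk measurable_pert
      (measurableSet_mem_leaderSet i)
  refine (integral_mono ((R.integrable_loss_apply ht i).indicator (R.measurableSet_exploit ht i))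
    ((R.integrable_loss_apply ht i).indicator measurableSet_leader)
    (Set.indicator_le_indicator_of_subset subset_leaderSet loss_nonneg)).trans_eq ?_
  exact integral_indicator_mem_leaderSet measurable_pert.aemeasurable
    (measurable_lhat.mono (R.history.le t) le_rfl).aemeasurable (R.integrable_loss_apply ht i)
    (R.map_pert t ht) indep i

theorem integral_indicator_explore (ht : t ∈ Finset.Icc 1 T) (i : Fin K) {Y : Ω → ℝ}
    (hY : Measurable[R.pastLoss t] Y) (hYint : Integrable Y P) :
    ∫ ω, (R.explore t ⁻¹' {i}).indicator Y ω ∂P = ∫ ω, R.probExplore t ω i * Y ω ∂P := by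
  have le_mΩ : R.pastLoss t ⊔ MeasurableSpace.comap (R.pert t) inferInstance ≤ mΩ :=
    sup_le (R.pastLoss_le ht)
      ((R.measurable_pert t ht).mono (R.history.le _) le_rfl).comap_le
  have measurableSet_explore := R.measurableSet_explore ht i
  have indicator_eq : (R.explore t ⁻¹' {i}).indicator Y
      = Y * (R.explore t ⁻¹' {i}).indicator fun _ => (1 : ℝ) := by
    classical ext ω; simp [Set.indicator_apply]
  have condExp_eq := condExp_mul_of_stronglyMeasurable_left (μ := P)
    (hY.mono (le_sup_left : _ ≤ R.pastLoss t ⊔ MeasurableSpace.comap (R.pert t) inferInstance)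
      le_rfl).stronglyMeasurable (indicator_eq ▸ hYint.indicator measurableSet_explore)
    ((integrable_const (1 : ℝ)).indicator measurableSet_explore)
  rw [← integral_condExp le_mΩ, indicator_eq]
  refine integral_congr_ae ?_
  filter_upwards [condExp_eq, R.condExp_explore t ht i] with ω hω condExp_explore
  rw [hω, Pi.mul_apply, condExp_explore, mul_comm, probExplore]

theorem integral_estimate_mul (hα : 0 < α) (hη : ∀ t ∈ Finset.Icc 1 T, 0 < η t)
    (ht : t ∈ Finset.Icc 1 T) (i : Fin K) {Z : Ω → ℝ} (hZ : Measurable[R.pastLoss t] Z)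
    (hZint : Integrable Z P) :
    ∫ ω, R.estimate t ω i * Z ω ∂P = ∫ ω, R.loss t ω i * Z ω ∂P := by
  obtain ⟨C, hC⟩ := R.exists_abs_loss_div_probExplore_le hα hη ht
  have measurable_div := R.measurable_pastLoss_loss_div_probExplore ht i
  have integrable_div_mul : Integrable (fun ω => R.loss t ω i / R.probExplore t ω i * Z ω) P :=
    hZint.bdd_mul (measurable_div.mono (R.pastLoss_le ht) le_rfl).aestronglyMeasurable
      (ae_of_all _ fun ω => hC ω i)
  calc ∫ ω, R.estimate t ω i * Z ω ∂P
      = ∫ ω, (R.explore t ⁻¹' {i}).indicator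
          (fun ω => R.loss t ω i / R.probExplore t ω i * Z ω) ω ∂P := by
        simp only [R.estimate_apply_eq_indicator, Set.indicator_mul_left]
    _ = ∫ ω, R.probExplore t ω i * (R.loss t ω i / R.probExplore t ω i * Z ω) ∂P :=
        R.integral_indicator_explore ht i (measurable_div.mul hZ) integrable_div_mul
    _ = ∫ ω, R.loss t ω i * Z ω ∂P := by
        refine integral_congr_ae (ae_of_all _ fun ω => ?_)
        have := (R.probExplore_pos ht (hη t ht).le ω i).ne'
        field_simp

theorem integral_estimate (hα : 0 < α) (hη : ∀ t ∈ Finset.Icc 1 T, 0 < η t)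
    (ht : t ∈ Finset.Icc 1 T) (i : Fin K) :
    ∫ ω, R.estimate t ω i ∂P = ∫ ω, R.loss t ω i ∂P := by
  simpa using R.integral_estimate_mul hα hη ht i (measurable_const (a := (1 : ℝ)))
    (integrable_const 1)

theorem integral_estimate_mul_probExploit (hα : 0 < α) (hη : ∀ t ∈ Finset.Icc 1 T, 0 < η t)
    (ht : t ∈ Finset.Icc 1 T) (i : Fin K) :
    ∫ ω, R.estimate t ω i * R.probExploit t ω i ∂P
      = ∫ ω, R.loss t ω i * R.probExploit t ω i ∂P :=
  R.integral_estimate_mul hα hη ht i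
    ((R.measurable_history_probExploit hα ht i).mono (R.history_le_pastLoss t) le_rfl)
    (R.integrable_probExploit hα ht i)

end Expectation

section Excess

variable {Ω : Type*} [MeasurableSpace Ω] {P : Measure Ω} {K T : ℕ} {α : ℝ} {η : ℕ → ℝ}

/-- The expected excess of the loss in round `t` of the perturbed leader over that of the
arm `k`. -/
noncomputable def excess (R : FTPLRun P K T α η) (t : ℕ) (k : Fin K) : ℝ :=
  ∑ i, ∫ ω, R.loss t ω i * R.probExploit t ω i ∂P - ∫ ω, R.loss t ω k ∂P

variable [IsProbabilityMeasure P] (R : FTPLRun P K T α η) {t : ℕ}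

theorem integral_sum_loss_exploit_le (hα : 0 < α) (hη : ∀ t ∈ Finset.Icc 1 T, 0 < η t) :
    ∫ ω, ∑ t ∈ Finset.Icc 1 T, R.loss t ω (R.exploit t ω) ∂P
      ≤ ∑ t ∈ Finset.Icc 1 T, ∑ i, ∫ ω, R.loss t ω i * R.probExploit t ω i ∂P := by
  have loss_exploit_eq (t : ℕ) (ω : Ω) : R.loss t ω (R.exploit t ω)
      = ∑ i, (R.exploit t ⁻¹' {i}).indicator (fun ω => R.loss t ω i) ω := by
    classical simp [Set.indicator_apply]
  have integrable_indicator (t : ℕ) (ht : t ∈ Finset.Icc 1 T) (i : Fin K) :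
      Integrable ((R.exploit t ⁻¹' {i}).indicator fun ω => R.loss t ω i) P :=
    (R.integrable_loss_apply ht i).indicator (R.measurableSet_exploit ht i)
  simp_rw [loss_exploit_eq]
  rw [integral_finsetSum _ fun t ht =>
    integrable_finsetSum _ fun i _ => integrable_indicator t ht i]
  refine Finset.sum_le_sum fun t ht => ?_
  rw [integral_finsetSum _ fun i _ => integrable_indicator t ht i]
  exact Finset.sum_le_sum fun i _ => R.integral_indicator_exploit_loss_le hα ht (hη t ht) i

variable {Δ : Fin K → Fin K → ℝ}

theorem integral_mul_loss_sub (hΔ : R.IsStochasticallyConstrained Δ) (ht : t ∈ Finset.Icc 1 T)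
    (i k : Fin K) {Z : Ω → ℝ} (hZ : Measurable[R.history t] Z) (hZint : Integrable Z P) :
    ∫ ω, Z ω * (R.loss t ω i - R.loss t ω k) ∂P = Δ i k * ∫ ω, Z ω ∂P := by
  have integrable_sub := (R.integrable_loss_apply ht i).sub (R.integrable_loss_apply ht k)
  have integrable_mul : Integrable (Z * fun ω => R.loss t ω i - R.loss t ω k) P := by
    refine hZint.mul_bdd (c := 1 + 1) integrable_sub.aestronglyMeasurable (ae_of_all _ fun ω => ?_)
    exact (norm_sub_le _ _).trans
      (add_le_add (R.abs_loss_le_one ht ω i) (R.abs_loss_le_one ht ω k))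
  have condExp_eq := condExp_mul_of_stronglyMeasurable_left (μ := P) hZ.stronglyMeasurable
    integrable_mul integrable_sub
  rw [← integral_const_mul]
  refine (integral_condExp (R.history.le t)).symm.trans (integral_congr_ae ?_)
  filter_upwards [condExp_eq, hΔ t ht i k] with ω hω condExp_gap
  refine hω.trans ?_
  rw [Pi.mul_apply, mul_comm]
  exact congrArg (· * Z ω) condExp_gap

theorem integral_loss_sub (hΔ : R.IsStochasticallyConstrained Δ) (ht : t ∈ Finset.Icc 1 T)
    (i k : Fin K) : ∫ ω, R.loss t ω i ∂P - ∫ ω, R.loss t ω k ∂P = Δ i k := by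
  rw [← integral_sub (R.integrable_loss_apply ht i) (R.integrable_loss_apply ht k)]
  simpa using R.integral_mul_loss_sub hΔ ht i k (measurable_const (a := (1 : ℝ)))
    (integrable_const 1)

theorem gap_le_one (hΔ : R.IsStochasticallyConstrained Δ) (ht : t ∈ Finset.Icc 1 T)
    (i k : Fin K) : Δ i k ≤ 1 := by
  have integral_le : ∫ ω, R.loss t ω i ∂P ≤ 1 := by
    simpa using integral_mono (R.integrable_loss_apply ht i) (integrable_const 1)
      fun ω => (R.loss_mem t ht ω i).2
  have integral_nonneg : 0 ≤ ∫ ω, R.loss t ω k ∂P :=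
    integral_nonneg fun ω => (R.loss_mem t ht ω k).1
  linarith [R.integral_loss_sub hΔ ht i k]

theorem sum_integral_loss_le_iInf (hΔ : R.IsStochasticallyConstrained Δ) {k : Fin K}
    (hk : ∀ i, i ≠ k → 0 < Δ i k) :
    ∑ t ∈ Finset.Icc 1 T, ∫ ω, R.loss t ω k ∂P
      ≤ ⨅ i : Fin K, ∫ ω, ∑ t ∈ Finset.Icc 1 T, R.loss t ω i ∂P := by
  have : Nonempty (Fin K) := ⟨k⟩
  refine le_ciInf fun i => ?_
  rw [integral_finsetSum _ fun t ht => R.integrable_loss_apply ht i]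
  refine Finset.sum_le_sum fun t ht => ?_
  rcases eq_or_ne i k with rfl | hik
  · exact le_rfl
  · linarith [R.integral_loss_sub hΔ ht i k, hk i hik]

theorem pseudoRegret_le_sum_excess (hα : 0 < α) (hη : ∀ t ∈ Finset.Icc 1 T, 0 < η t)
    (hΔ : R.IsStochasticallyConstrained Δ) {k : Fin K} (hk : ∀ i, i ≠ k → 0 < Δ i k) :
    R.pseudoRegret ≤ ∑ t ∈ Finset.Icc 1 T, R.excess t k := by
  simp only [excess, Finset.sum_sub_distrib]
  exact sub_le_sub (R.integral_sum_loss_exploit_le hα hη) (R.sum_integral_loss_le_iInf hΔ hk)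

theorem excess_eq (hα : 0 < α) (hΔ : R.IsStochasticallyConstrained Δ) (ht : t ∈ Finset.Icc 1 T)
    (k : Fin K) :
    R.excess t k = ∑ i ∈ Finset.univ.erase k, Δ i k * ∫ ω, R.probExploit t ω i ∂P := by
  have : Nonempty (Fin K) := ⟨k⟩
  have integral_loss_eq :
      ∫ ω, R.loss t ω k ∂P = ∑ i, ∫ ω, R.loss t ω k * R.probExploit t ω i ∂P := by
    rw [← integral_finsetSum _ fun i _ => R.integrable_loss_mul_probExploit hα ht k i]
    simp only [← Finset.mul_sum, R.sum_probExploit hα, mul_one]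
  have gap_eq (i : Fin K) : ∫ ω, R.loss t ω i * R.probExploit t ω i ∂P
      - ∫ ω, R.loss t ω k * R.probExploit t ω i ∂P
        = ∫ ω, R.probExploit t ω i * (R.loss t ω i - R.loss t ω k) ∂P := by
    rw [← integral_sub (R.integrable_loss_mul_probExploit hα ht i i)
      (R.integrable_loss_mul_probExploit hα ht k i)]
    simp only [mul_sub, mul_comm]
  rw [excess, integral_loss_eq, ← Finset.sum_sub_distrib, ← Finset.add_sum_erase _ _
    (Finset.mem_univ k), sub_self, zero_add]
  refine Finset.sum_congr rfl fun i _ => ?_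
  rw [gap_eq]
  exact R.integral_mul_loss_sub hΔ ht i k (R.measurable_history_probExploit hα ht i)
    (R.integrable_probExploit hα ht i)

end Excess

section Stability

variable {Ω : Type*} [mΩ : MeasurableSpace Ω] {P : Measure Ω} {K T : ℕ} {α : ℝ} {η : ℕ → ℝ}

/-- The probability with which the arm `i` would be exploited in round `t` if the loss estimates
of round `t` that come from exploring `i` and observing the loss `x` were already included. -/
noncomputable def probAfter (R : FTPLRun P K T α η) (t : ℕ) (ω : Ω) (i : Fin K) (x : ℝ) : ℝ :=
  leaderProb (paretoMeasure 1 α)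
    (η t • R.lhat t ω + Pi.single i (η t * x / R.probExplore t ω i)) i

variable (R : FTPLRun P K T α η) {t : ℕ}

theorem stability_eq_sum (t : ℕ) (ω : Ω) :
    stability α (η t) (R.lhat t ω) (R.rank t ω)
      = ∑ i, (R.probExploit t ω i - R.probAfter t ω i 1) := by
  simp only [stability, probExploit, probAfter, probExplore, mul_one]

theorem estimate_mul_probHindsight (ht : t ∈ Finset.Icc 1 T) (ω : Ω) (i : Fin K) :
    R.estimate t ω i * R.probHindsight t ω i
      = R.estimate t ω i * R.probAfter t ω i (R.loss t ω i) := by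
  by_cases h : R.explore t ω = i
  · subst h
    rw [probHindsight, R.lhat_succ_eq_add_estimate ht, smul_add, estimate, ← Pi.single_smul,
      smul_eq_mul, ← mul_div_assoc, probAfter]
  · simp [estimate, Pi.single_eq_of_ne (Ne.symm h)]

theorem probAfter_nonneg (t : ℕ) (ω : Ω) (i : Fin K) (x : ℝ) : 0 ≤ R.probAfter t ω i x :=
  leaderProb_nonneg _ i

theorem antitone_probAfter (hα : 0 < α) (ht : t ∈ Finset.Icc 1 T) (hη : 0 ≤ η t) (ω : Ω)
    (i : Fin K) : Antitone (R.probAfter t ω i) := by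
  have := isProbabilityMeasure_paretoMeasure one_pos hα
  have probExplore_pos := R.probExplore_pos ht hη ω i
  refine (leaderProb_add_single_antitone _ i).comp_monotone fun x y hxy => ?_
  gcongr

theorem probAfter_zero (t : ℕ) (ω : Ω) (i : Fin K) :
    R.probAfter t ω i 0 = R.probExploit t ω i := by
  simp [probAfter, probExploit]

theorem probAfter_le_probExploit (hα : 0 < α) (ht : t ∈ Finset.Icc 1 T) (hη : 0 ≤ η t) (ω : Ω)
    (i : Fin K) {x : ℝ} (hx : 0 ≤ x) : R.probAfter t ω i x ≤ R.probExploit t ω i :=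
  R.probAfter_zero t ω i ▸ R.antitone_probAfter hα ht hη ω i hx

theorem measurable_probAfter (hα : 0 < α) (ht : t ∈ Finset.Icc 1 T) (i : Fin K) {x : Ω → ℝ}
    (hx : Measurable[R.pastLoss t] x) :
    Measurable[R.pastLoss t] fun ω => R.probAfter t ω i (x ω) := by
  have := isProbabilityMeasure_paretoMeasure one_pos hα
  have measurable_shift : Measurable[R.pastLoss t] fun ω =>
      (Pi.single i (η t * x ω / R.probExplore t ω i) : Fin K → ℝ) :=
    (continuous_single i).measurable.comp ((hx.const_mul (η t)).div
      ((R.measurable_history_probExplore ht i).mono (R.history_le_pastLoss t) le_rfl))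
  exact (measurable_leaderProb i).comp
    (((R.measurable_history_smul_lhat ht).mono (R.history_le_pastLoss t) le_rfl).add
      measurable_shift)

variable [IsProbabilityMeasure P]

theorem integrable_probAfter (hα : 0 < α) (ht : t ∈ Finset.Icc 1 T) (i : Fin K) {x : Ω → ℝ}
    (hx : Measurable[R.pastLoss t] x) : Integrable (fun ω => R.probAfter t ω i (x ω)) P := by
  have := isProbabilityMeasure_paretoMeasure one_pos hα
  refine Integrable.of_bound ((R.measurable_probAfter hα ht i hx).mono (R.pastLoss_le ht)
    le_rfl).aestronglyMeasurable 1 (ae_of_all _ fun ω => ?_)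
  rw [Real.norm_of_nonneg (R.probAfter_nonneg t ω i _)]
  exact leaderProb_le_one _ i

theorem integrable_probExploit_sub_probAfter (hα : 0 < α) (ht : t ∈ Finset.Icc 1 T) (i : Fin K)
    {x : Ω → ℝ} (hx : Measurable[R.pastLoss t] x) :
    Integrable (fun ω => R.probExploit t ω i - R.probAfter t ω i (x ω)) P :=
  (R.integrable_probExploit hα ht i).sub (R.integrable_probAfter hα ht i hx)

theorem integrable_stability (hα : 0 < α) (ht : t ∈ Finset.Icc 1 T) :
    Integrable (fun ω => stability α (η t) (R.lhat t ω) (R.rank t ω)) P := by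
  simp only [stability_eq_sum]
  exact integrable_finsetSum _ fun i _ =>
    R.integrable_probExploit_sub_probAfter hα ht i measurable_const

theorem integral_estimate_mul_sub_le (hα : 0 < α) (hη : ∀ t ∈ Finset.Icc 1 T, 0 < η t)
    (ht : t ∈ Finset.Icc 1 T) (i : Fin K) :
    ∫ ω, R.estimate t ω i * (R.probExploit t ω i - R.probHindsight t ω i) ∂P
      ≤ ∫ ω, (R.probExploit t ω i - R.probAfter t ω i 1) ∂P := by
  have measurable_loss := R.measurable_pastLoss_loss_apply t i
  have integrable_sub := R.integrable_probExploit_sub_probAfter hα ht i measurable_loss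
  calc ∫ ω, R.estimate t ω i * (R.probExploit t ω i - R.probHindsight t ω i) ∂P
      = ∫ ω, R.estimate t ω i * (R.probExploit t ω i - R.probAfter t ω i (R.loss t ω i)) ∂P := by
        simp only [mul_sub, R.estimate_mul_probHindsight ht]
    _ = ∫ ω, R.loss t ω i * (R.probExploit t ω i - R.probAfter t ω i (R.loss t ω i)) ∂P :=
        R.integral_estimate_mul hα hη ht i
          (((R.measurable_history_probExploit hα ht i).mono (R.history_le_pastLoss t) le_rfl).sub
            (R.measurable_probAfter hα ht i measurable_loss)) integrable_sub
    _ ≤ ∫ ω, (R.probExploit t ω i - R.probAfter t ω i 1) ∂P := by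
        refine integral_mono (integrable_sub.bdd_mul
            (R.integrable_loss_apply ht i).aestronglyMeasurable
            (ae_of_all _ fun ω => R.abs_loss_le_one ht ω i))
          (R.integrable_probExploit_sub_probAfter hα ht i measurable_const) fun ω => ?_
        obtain ⟨loss_nonneg, loss_le_one⟩ := R.loss_mem t ht ω i
        have sub_nonneg := sub_nonneg.2
          (R.probAfter_le_probExploit hα ht (hη t ht).le ω i loss_nonneg)
        exact (mul_le_of_le_one_left sub_nonneg loss_le_one).trans
          (sub_le_sub_left (R.antitone_probAfter hα ht (hη t ht).le ω i loss_le_one) _)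

theorem sum_integral_estimate_mul_sub_le_integral_stability (hα : 0 < α)
    (hη : ∀ t ∈ Finset.Icc 1 T, 0 < η t) (ht : t ∈ Finset.Icc 1 T) :
    ∑ i, ∫ ω, R.estimate t ω i * (R.probExploit t ω i - R.probHindsight t ω i) ∂P
      ≤ ∫ ω, stability α (η t) (R.lhat t ω) (R.rank t ω) ∂P := by
  simp only [stability_eq_sum]
  rw [integral_finsetSum _ fun i _ =>
    R.integrable_probExploit_sub_probAfter hα ht i measurable_const]
  exact Finset.sum_le_sum fun i _ => R.integral_estimate_mul_sub_le hα hη ht i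

end Stability

section RegretDecomposition

variable {Ω : Type*} [MeasurableSpace Ω] {P : Measure Ω} {K T : ℕ} {α : ℝ} {η : ℕ → ℝ}
  (R : FTPLRun P K T α η) {t : ℕ}

theorem sum_estimate_mul_probHindsight_sub_le (hα : 1 < α) (hη0 : η 0 = 0)
    (hη : ∀ t ∈ Finset.Icc 1 T, 0 < η t)
    (hmono : ∀ t ∈ Finset.Icc 1 T, (η (t - 1))⁻¹ ≤ (η t)⁻¹) (k : Fin K) (ω : Ω) :
    ∑ t ∈ Finset.Icc 1 T, (∑ i, R.estimate t ω i * R.probHindsight t ω i - R.estimate t ω k)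
      ≤ ∑ t ∈ Finset.Icc 1 T, ∑ i ∈ Finset.univ.erase k, ((η t)⁻¹ - (η (t - 1))⁻¹) *
          (paretoTailConst α * R.probExploit t ω i ^ (1 - 1 / α)) := by
  have : Nonempty (Fin K) := ⟨k⟩
  have estimate_eq (t : ℕ) (ht : t ∈ Finset.Icc 1 T) (i : Fin K) :
      R.lhat (t + 1) ω i - R.lhat t ω i = R.estimate t ω i := by
    rw [R.lhat_succ_eq_add_estimate ht, Pi.add_apply, add_sub_cancel_left]
  have be_the_leader := sum_sum_sub_mul_leaderProb_paretoMeasure_le (L := fun t => R.lhat t ω)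
    hα (R.lhat_one ω) hη0 hη hmono k
  rw [R.lhat_succ_eq_sum_estimate le_rfl, Finset.sum_apply, Finset.sum_congr rfl fun t ht =>
    Finset.sum_congr rfl fun i _ => by rw [estimate_eq t ht i]] at be_the_leader
  simp only [Finset.sum_sub_distrib, ← Finset.mul_sum] at be_the_leader ⊢
  exact sub_le_iff_le_add'.2 be_the_leader

variable [IsProbabilityMeasure P]

theorem excess_eq_integral_estimate (hα : 0 < α) (hη : ∀ t ∈ Finset.Icc 1 T, 0 < η t)
    (ht : t ∈ Finset.Icc 1 T) (k : Fin K) :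
    R.excess t k
      = ∑ i, ∫ ω, R.estimate t ω i * (R.probExploit t ω i - R.probHindsight t ω i) ∂P
        + ∫ ω, (∑ i, R.estimate t ω i * R.probHindsight t ω i - R.estimate t ω k) ∂P := by
  have integrable_hindsight (i : Fin K) := R.integrable_estimate_mul_probHindsight hα hη ht i
  rw [excess, ← R.integral_estimate hα hη ht k,
    integral_sub (integrable_finsetSum _ fun i _ => integrable_hindsight i)
      (R.integrable_estimate hα hη ht k),
    integral_finsetSum _ fun i _ => integrable_hindsight i, ← add_sub_assoc,
    ← Finset.sum_add_distrib]
  refine congrArg (· - _) (Finset.sum_congr rfl fun i _ => ?_)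
  simp only [mul_sub]
  rw [integral_sub (R.integrable_estimate_mul_probExploit hα hη ht i) (integrable_hindsight i),
    sub_add_cancel, R.integral_estimate_mul_probExploit hα hη ht]

theorem sum_excess_le (hα : 1 < α) (hη0 : η 0 = 0) (hη : ∀ t ∈ Finset.Icc 1 T, 0 < η t)
    (hmono : ∀ t ∈ Finset.Icc 1 T, (η (t - 1))⁻¹ ≤ (η t)⁻¹) (k : Fin K) :
    ∑ t ∈ Finset.Icc 1 T, R.excess t k
      ≤ ∑ t ∈ Finset.Icc 1 T, ∫ ω, stability α (η t) (R.lhat t ω) (R.rank t ω) ∂P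
        + ∑ t ∈ Finset.Icc 1 T, ∑ i ∈ Finset.univ.erase k, ∫ ω, ((η t)⁻¹ - (η (t - 1))⁻¹) *
            (paretoTailConst α * R.probExploit t ω i ^ (1 - 1 / α)) ∂P := by
  have hα0 : 0 < α := one_pos.trans hα
  have integrable_hindsight (t : ℕ) (ht : t ∈ Finset.Icc 1 T) : Integrable (fun ω =>
      ∑ i, R.estimate t ω i * R.probHindsight t ω i - R.estimate t ω k) P :=
    (integrable_finsetSum _ fun i _ => R.integrable_estimate_mul_probHindsight hα0 hη ht i).sub
      (R.integrable_estimate hα0 hη ht k)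
  have integrable_penalty (t : ℕ) (ht : t ∈ Finset.Icc 1 T) (i : Fin K) : Integrable (fun ω =>
      ((η t)⁻¹ - (η (t - 1))⁻¹) * (paretoTailConst α * R.probExploit t ω i ^ (1 - 1 / α))) P :=
    ((R.integrable_probExploit_rpow hα0 ht i (sub_nonneg.2
      ((div_le_one hα0).2 hα.le))).const_mul _).const_mul _
  rw [Finset.sum_congr rfl fun t ht => R.excess_eq_integral_estimate hα0 hη ht k,
    Finset.sum_add_distrib]
  refine add_le_add (Finset.sum_le_sum fun t ht =>
    R.sum_integral_estimate_mul_sub_le_integral_stability hα0 hη ht) ?_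
  rw [← integral_finsetSum _ integrable_hindsight, Finset.sum_congr rfl fun t ht =>
      (integral_finsetSum _ fun i _ => integrable_penalty t ht i).symm,
    ← integral_finsetSum _ fun t ht => integrable_finsetSum _ fun i _ => integrable_penalty t ht i]
  exact integral_mono (integrable_finsetSum _ integrable_hindsight)
    (integrable_finsetSum _ fun t ht => integrable_finsetSum _ fun i _ =>
      integrable_penalty t ht i)
    (R.sum_estimate_mul_probHindsight_sub_le hα hη0 hη hmono k)

end RegretDecomposition

section SelfBounding

variable {Ω : Type*} [MeasurableSpace Ω] {P : Measure Ω} [IsProbabilityMeasure P] {K T : ℕ}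
  {α : ℝ} {η : ℕ → ℝ} (R : FTPLRun P K T α η) {t : ℕ} {Δ : Fin K → Fin K → ℝ} {k : Fin K} {D : ℝ}

theorem mul_one_sub_integral_probExploit_le_excess (hα : 0 < α)
    (hΔ : R.IsStochasticallyConstrained Δ) (ht : t ∈ Finset.Icc 1 T)
    (hD : ∀ i, i ≠ k → D ≤ Δ i k) :
    D * (1 - ∫ ω, R.probExploit t ω k ∂P) ≤ R.excess t k := by
  have : Nonempty (Fin K) := ⟨k⟩
  have sum_integral : ∑ i, ∫ ω, R.probExploit t ω i ∂P = 1 := by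
    rw [← integral_finsetSum _ fun i _ => R.integrable_probExploit hα ht i]
    simp [R.sum_probExploit hα]
  rw [R.excess_eq hα hΔ ht, ← sum_integral, ← Finset.add_sum_erase _ _ (Finset.mem_univ k),
    add_sub_cancel_left, Finset.mul_sum]
  gcongr with i hi
  · exact integral_nonneg fun ω => R.probExploit_nonneg t ω i
  · exact hD i (Finset.ne_of_mem_erase hi)

theorem exists_integral_stability_le (hα : 1 < α) (hα3 : α ≤ 3) :
    ∃ C > 0, ∀ {Ω : Type*} [MeasurableSpace Ω] {P : Measure Ω} [IsProbabilityMeasure P]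
      {K T : ℕ} [Nontrivial (Fin K)] {η : ℕ → ℝ} (R : FTPLRun P K T α η)
      {Δ : Fin K → Fin K → ℝ} {t : ℕ} {k : Fin K} {D : ℝ}, R.IsStochasticallyConstrained Δ →
      t ∈ Finset.Icc 1 T → 0 ≤ η t → 0 < D → (∀ i, i ≠ k → D ≤ Δ i k) →
        ∫ ω, stability α (η t) (R.lhat t ω) (R.rank t ω) ∂P
          ≤ R.excess t k / 4 + C * min (η t * (K : ℝ) ^ (1 - 1 / α))
              ((η t * (K : ℝ) ^ (1 - 1 / α)) ^ 3 / D ^ 2) := by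
  obtain ⟨C, hC, stability_le⟩ := exists_stability_le hα hα3
  refine ⟨C, hC, fun {Ω _ P _ K T _ η} R {Δ t k D} hΔ ht hη hD0 hD => ?_⟩
  have hα0 : 0 < α := one_pos.trans hα
  obtain ⟨i, hi⟩ := exists_ne k
  have D_le_one : D ≤ 1 := (hD i hi).trans (R.gap_le_one hΔ ht i k)
  have integrable_prob := R.integrable_probExploit hα0 ht k
  have integrable_main : Integrable (fun ω => D * (1 - R.probExploit t ω k) / 4) P :=
    (((integrable_const 1).sub integrable_prob).const_mul D).div_const 4
  refine (integral_mono (R.integrable_stability hα0 ht)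
    (integrable_main.add (integrable_const _)) fun ω =>
      stability_le K (η t) (R.lhat t ω) (R.rank t ω) D k hη (R.isRanking t ht ω) hD0
        D_le_one).trans ?_
  rw [integral_add' integrable_main (integrable_const _), integral_div, integral_const_mul,
    integral_sub (integrable_const 1) integrable_prob]
  simp only [integral_const, probReal_univ, one_smul]
  gcongr
  exact R.mul_one_sub_integral_probExploit_le_excess hα0 hΔ ht hD

end SelfBounding

section Regret

variable {Ω : Type*} [MeasurableSpace Ω] {P : Measure Ω} [IsProbabilityMeasure P] {K T : ℕ}
  {α c : ℝ} (R : FTPLRun P K T α (learningRate α c K)) {Δ : Fin K → Fin K → ℝ} {t : ℕ} {k : Fin K}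

theorem integral_penalty_le (hα : 1 < α) (hα3 : α ≤ 3) (hc : 0 < c) (ht : t ∈ Finset.Icc 1 T)
    (i : Fin K) {δ : ℝ} (hδ : 0 < δ) :
    ∫ ω, ((learningRate α c K t)⁻¹ - (learningRate α c K (t - 1))⁻¹) *
        (paretoTailConst α * R.probExploit t ω i ^ (1 - 1 / α)) ∂P
      ≤ δ * (∫ ω, R.probExploit t ω i ∂P) / 4 + 4 ^ (α - 1) * (paretoTailConst α / c) ^ α *
          (√K * δ ^ (1 - α) * (t : ℝ) ^ (-α / 2)) := by
  have hα0 : 0 < α := one_pos.trans hα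
  have exponent_nonneg : 0 ≤ 1 - 1 / α := sub_nonneg.2 ((div_le_one hα0).2 hα.le)
  have integrable_main : Integrable (fun ω => δ * R.probExploit t ω i / 4) P :=
    ((R.integrable_probExploit hα0 ht i).const_mul δ).div_const 4
  refine (integral_mono
    (((R.integrable_probExploit_rpow hα0 ht i exponent_nonneg).const_mul _).const_mul _)
    (integrable_main.add (integrable_const _)) fun ω =>
      inv_learningRate_sub_mul_le hα hα3 hc i.pos t hδ (R.probExploit_nonneg t ω i)).trans_eq ?_
  rw [integral_add' integrable_main (integrable_const _), integral_div, integral_const_mul,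
    integral_const, probReal_univ, one_smul]

theorem sum_integral_penalty_le (hα : 1 < α) (hα3 : α ≤ 3) (hc : 0 < c)
    (hΔ : R.IsStochasticallyConstrained Δ) (hk : ∀ i, i ≠ k → 0 < Δ i k) :
    ∑ t ∈ Finset.Icc 1 T, ∑ i ∈ Finset.univ.erase k,
        ∫ ω, ((learningRate α c K t)⁻¹ - (learningRate α c K (t - 1))⁻¹) *
          (paretoTailConst α * R.probExploit t ω i ^ (1 - 1 / α)) ∂P
      ≤ (∑ t ∈ Finset.Icc 1 T, R.excess t k) / 4
        + 4 ^ (α - 1) * (paretoTailConst α / c) ^ α *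
          ∑ t ∈ Finset.Icc 1 T, ∑ i ∈ Finset.univ.erase k,
            √K * Δ i k ^ (1 - α) * (t : ℝ) ^ (-α / 2) := by
  rw [Finset.sum_div, Finset.mul_sum, ← Finset.sum_add_distrib]
  refine Finset.sum_le_sum fun t ht => ?_
  rw [R.excess_eq (one_pos.trans hα) hΔ ht, Finset.sum_div, Finset.mul_sum,
    ← Finset.sum_add_distrib]
  exact Finset.sum_le_sum fun i hi =>
    R.integral_penalty_le hα hα3 hc ht i (hk i (Finset.ne_of_mem_erase hi))

theorem exists_sum_integral_stability_le (hα : 1 < α) (hα3 : α ≤ 3) (hc : 0 < c) :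
    ∃ C > 0, ∀ {Ω : Type*} [MeasurableSpace Ω] {P : Measure Ω} [IsProbabilityMeasure P]
      {K T : ℕ} [Nontrivial (Fin K)] (R : FTPLRun P K T α (learningRate α c K))
      {Δ : Fin K → Fin K → ℝ} {k : Fin K} {D : ℝ}, R.IsStochasticallyConstrained Δ →
      0 < D → (∀ i, i ≠ k → D ≤ Δ i k) →
        ∑ t ∈ Finset.Icc 1 T,
            ∫ ω, stability α (learningRate α c K t) (R.lhat t ω) (R.rank t ω) ∂P
          ≤ (∑ t ∈ Finset.Icc 1 T, R.excess t k) / 4 + C * (K / D) := by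
  obtain ⟨C, hC, stability_le⟩ := exists_integral_stability_le hα hα3
  refine ⟨C * (8 * c ^ 2), by positivity, fun {Ω _ P _ K T _} R {Δ k D} hΔ hD0 hD => ?_⟩
  have hK : (0 : ℝ) < K := by exact_mod_cast k.pos
  calc ∑ t ∈ Finset.Icc 1 T, ∫ ω, stability α (learningRate α c K t) (R.lhat t ω) (R.rank t ω) ∂P
      ≤ ∑ t ∈ Finset.Icc 1 T, (R.excess t k / 4
          + C * min (c * √K / √t) ((c * √K / √t) ^ 3 / D ^ 2)) := by
        refine Finset.sum_le_sum fun t ht => ?_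
        have := stability_le R hΔ ht
          (learningRate_pos hc k.pos (Finset.mem_Icc.1 ht).1).le hD0 hD
        rwa [learningRate_mul_rpow k.pos] at this
    _ = (∑ t ∈ Finset.Icc 1 T, R.excess t k) / 4
          + C * ∑ t ∈ Finset.Icc 1 T, min (c * √K / √t) ((c * √K / √t) ^ 3 / D ^ 2) := by
        rw [Finset.sum_add_distrib, Finset.sum_div, Finset.mul_sum]
    _ ≤ (∑ t ∈ Finset.Icc 1 T, R.excess t k) / 4 + C * (8 * (c * √K) ^ 2 / D) := by
        gcongr
        exact sum_min_div_sqrt_le (by positivity) hD0 T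
    _ = (∑ t ∈ Finset.Icc 1 T, R.excess t k) / 4 + C * (8 * c ^ 2) * (K / D) := by
        rw [mul_pow, Real.sq_sqrt hK.le]
        ring

theorem exists_pseudoRegret_le (hα : 1 < α) (hα3 : α ≤ 3) (hc : 0 < c) :
    ∃ C > 0, ∀ {Ω : Type*} [MeasurableSpace Ω] {P : Measure Ω} [IsProbabilityMeasure P]
      {K T : ℕ} [Nontrivial (Fin K)] (R : FTPLRun P K T α (learningRate α c K))
      {Δ : Fin K → Fin K → ℝ} {k : Fin K} {D : ℝ}, R.IsStochasticallyConstrained Δ →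
      0 < D → (∀ i, i ≠ k → D ≤ Δ i k) →
        R.pseudoRegret ≤ C * ((∑ t ∈ Finset.Icc 1 T, ∑ i ∈ Finset.univ.erase k,
          √K * Δ i k ^ (1 - α) * (t : ℝ) ^ (-α / 2)) + K / D) := by
  obtain ⟨C, hC, stability_le⟩ := exists_sum_integral_stability_le hα hα3 hc
  have tail_pos := paretoTailConst_pos hα
  set Cp := 4 ^ (α - 1) * (paretoTailConst α / c) ^ α
  have hCp : 0 < Cp := by positivity
  refine ⟨2 * (Cp + C), by positivity, fun {Ω _ P _ K T _} R {Δ k D} hΔ hD0 hD => ?_⟩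
  have gap_pos (i : Fin K) (hi : i ≠ k) : 0 < Δ i k := hD0.trans_le (hD i hi)
  have rate_pos : ∀ t ∈ Finset.Icc 1 T, 0 < learningRate α c K t := fun t ht =>
    learningRate_pos hc k.pos (Finset.mem_Icc.1 ht).1
  have regret_le := R.pseudoRegret_le_sum_excess (one_pos.trans hα) rate_pos hΔ gap_pos
  have excess_le := R.sum_excess_le hα learningRate_zero rate_pos
    (fun t _ => monotone_inv_learningRate hc k.pos t.pred_le) k
  have penalty_le := R.sum_integral_penalty_le hα hα3 hc hΔ gap_pos
  have stability_le := stability_le R hΔ hD0 hD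
  set S := ∑ t ∈ Finset.Icc 1 T, ∑ i ∈ Finset.univ.erase k,
    √K * Δ i k ^ (1 - α) * (t : ℝ) ^ (-α / 2)
  have S_nonneg : 0 ≤ S := Finset.sum_nonneg fun t _ => Finset.sum_nonneg fun i hi => by
    have := gap_pos i (Finset.ne_of_mem_erase hi)
    positivity
  calc R.pseudoRegret ≤ 2 * (Cp * S + C * (K / D)) := by linarith
    _ ≤ 2 * ((Cp + C) * S + (Cp + C) * (K / D)) := by gcongr <;> linarith
    _ = 2 * (Cp + C) * (S + K / D) := by ring

end Regret

end FTPLRun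

theorem sum_sum_mul_rpow_le_sum_mul_tsum {ι : Type*} {s : Finset ι} {a : ι → ℝ}
    (ha : ∀ i ∈ s, 0 ≤ a i) {p : ℝ} (hp : p < -1) (T : ℕ) :
    ∑ t ∈ Finset.Icc 1 T, ∑ i ∈ s, a i * (t : ℝ) ^ p
      ≤ (∑ i ∈ s, a i) * ∑' n : ℕ, (n : ℝ) ^ p := by
  simp only [← Finset.sum_mul, ← Finset.mul_sum]
  exact mul_le_mul_of_nonneg_left
    ((Real.summable_nat_rpow.2 hp).sum_le_tsum _ fun n _ => by positivity) (Finset.sum_nonneg ha)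

theorem theorem2 (α c : ℝ) (hα : 1 < α) (hα3 : α ≤ 3) (hc : 0 < c) :
    ∃ C : ℝ, 0 < C ∧
      ∀ (K T : ℕ) (_hK : 2 ≤ K)
        (Ω : Type*) [MeasurableSpace Ω] (P : Measure Ω) [IsProbabilityMeasure P]
        (R : FTPLRun P K T α (fun t => c * (K : ℝ) ^ (1 / α - 1 / 2) / √(t : ℝ)))
        (Δ : Fin K → Fin K → ℝ) (iStar : Fin K),
        R.IsStochasticallyConstrained Δ →
        (∀ i, i ≠ iStar → 0 < Δ i iStar) →
        R.pseudoRegret ≤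
            C * ((∑ t ∈ Finset.Icc 1 T, ∑ i ∈ Finset.univ.erase iStar,
                  √(K : ℝ) * Δ i iStar ^ (1 - α) * (t : ℝ) ^ (-α / 2))
                + K / (⨅ i : {i : Fin K // i ≠ iStar}, Δ i iStar)) ∧
          (2 < α →
            R.pseudoRegret ≤
              C * ((∑ i ∈ Finset.univ.erase iStar, √(K : ℝ) * Δ i iStar ^ (1 - α))
                + K / (⨅ i : {i : Fin K // i ≠ iStar}, Δ i iStar))) := by
  obtain ⟨C, hC, pseudoRegret_le⟩ := FTPLRun.exists_pseudoRegret_le hα hα3 hc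
  set Z := ∑' n : ℕ, (n : ℝ) ^ (-α / 2)
  have Z_nonneg : 0 ≤ Z := tsum_nonneg fun n => by positivity
  refine ⟨C * (1 + Z), by positivity, fun K T hK Ω _ P _ R Δ k hΔ gap_pos => ?_⟩
  have : Nontrivial (Fin K) := Fin.nontrivial_iff_two_le.2 hK
  have : Nonempty {i : Fin K // i ≠ k} := nonempty_subtype.2 (exists_ne k)
  obtain ⟨j, hj⟩ := exists_eq_ciInf_of_finite (f := fun i : {i : Fin K // i ≠ k} => Δ i k)
  have D_pos : 0 < ⨅ i : {i : Fin K // i ≠ k}, Δ i k := hj ▸ gap_pos j j.2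
  have regret_le := pseudoRegret_le R hΔ D_pos fun i hi =>
    ciInf_le (Set.finite_range fun i : {i : Fin K // i ≠ k} => Δ i k).bddBelow ⟨i, hi⟩
  set D := ⨅ i : {i : Fin K // i ≠ k}, Δ i k
  have weight_nonneg : ∀ i ∈ Finset.univ.erase k, 0 ≤ √(K : ℝ) * Δ i k ^ (1 - α) := fun i hi =>
    mul_nonneg (Real.sqrt_nonneg _) (Real.rpow_nonneg (gap_pos i (Finset.ne_of_mem_erase hi)).le _)
  refine ⟨regret_le.trans (mul_le_mul_of_nonneg_right
    (le_mul_of_one_le_right hC.le (by linarith)) ?_), fun hα2 => regret_le.trans ?_⟩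
  · exact add_nonneg (Finset.sum_nonneg fun t _ => Finset.sum_nonneg fun i hi =>
      mul_nonneg (weight_nonneg i hi) (by positivity)) (by positivity)
  · have sum_le := sum_sum_mul_rpow_le_sum_mul_tsum weight_nonneg (by linarith : -α / 2 < -1) T
    rw [mul_assoc]
    gcongr
    nlinarith [Finset.sum_nonneg weight_nonneg, mul_nonneg Z_nonneg (by positivity : 0 ≤ K / D)]
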